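/- Let $M$ be a smooth $n$-dimensional manifold and let $F:TM\to[0,\infty)$ be a Finsler structure on $M$: $F$ is $C^\infty$ on $TM_0=\{(x,y)\in TM: y\neq 0\}$, $F(x,\lambda y)=\lambda F(x,y)$ for $\lambda>0$, and $g_{ij}=\tfrac12\,\partial^2F^2/\partial y^i\partial y^j$ is positive definite on $TM_0$. In the coordinates $(x^i,y^i)$ of $TM$ induced by a chart of $M$, put $$G^i=\tfrac14 g^{il}\big([F^2]_{x^ky^l}y^k-[F^2]_{x^l}\big),\quad G^i_j=\frac{\partial G^i}{\partial y^j},\quad \frac{\delta}{\delta x^k}=\frac{\partial}{\partial x^k}-G^j_k\frac{\partial}{\partial y^j},\quad \delta y^k=dy^k+G^k_m\,dx^m,$$ and let $\nabla$ be the Cartan connection on $\pi^*TM$, where $\pi:TM_0\to M$; its connection form is $\omega^i_j=\Gamma^i_{jk}dx^k+C^i_{jk}\delta y^k$ with $$\Gamma^i_{jk}=\tfrac12 g^{il}\Big(\frac{\delta g_{lk}}{\delta x^j}+\frac{\delta g_{jl}}{\delta x^k}-\frac{\delta g_{jk}}{\delta x^l}\Big),\qquad C^i_{jk}=\tfrac12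 g^{il}\frac{\partial g_{jk}}{\partial y^l}.$$ For $\varphi\in C^\infty(M)$, a tangent vector $\hat X$ of $TM_0$ at $z$ with projection $\varrho\hat X=\pi_*\hat X$, and $Y$ in the fibre of $\pi^*TM$ at $z$, let $\mathrm{Hess}(\varphi)(\hat X,Y)=\hat X(Y\varphi)-(\nabla_{\hat X}Y)\varphi$ and define the Schwarzian tensor $$B_F(\varphi)(\hat X,Y)=\mathrm{Hess}(\varphi)(\hat X,Y)-d\varphi(\varrho\hat X)\,d\varphi(Y)-\tfrac1n\big(\Delta\varphi-\|\mathrm{grad}\,\varphi\|^2\big)\,g(\varrho\hat X,Y),$$ where $\varphi_k=\partial\varphi/\partial x^k$, $\|\mathrm{grad}\,\varphi\|^2=g^{ij}\varphi_i\varphi_j$, and $\Delta\varphi=g^{ij}\big(\tfrac{\partial^2\varphi}{\partial x^i\partial x^j}-\Gamma^k_{ij}\varphi_k\big)+g^{ij}\big(-C^k_{ij}\varphi_k\big)$ is the sum of the horizontal and the vertical Laplacian. A diffeomorphism $f:M\to M$ is a conformal transformation of $(M,F)$ if $f^*F:=F\circ df=e^{\varphi}F$ for some $\varphi\in C^\infty(M)$;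 it is a homothety if $\varphi$ can be taken constant, and a Möbius transformation if $\varphi$ can be taken with $B_F(\varphi)=0$, that is, $B_F(\varphi)(\hat X,Y)=0$ for all $z\in TM_0$, all $\hat X\in T_z(TM_0)$ and all $Y$. Theorem. Under composition, the conformal transformations of $(M,F)$ form a group (the conformal group of $(M,F)$), the Möbius transformations of $(M,F)$ form a subgroup of it, and the homotheties of $(M,F)$ form a group that is contained in the group of Möbius transformations. -/

import Mathlib

open scoped Manifold ContDiff

noncomputable section

namespace Finsler

/-- The group of smooth self-diffeomorphisms of a manifold; the product is composition. -/
instance diffeomorphGroup {n : ℕ} {M : Type*} [TopologicalSpace M]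
    [ChartedSpace (EuclideanSpace ℝ (Fin n)) M] : Group (M ≃ₘ⟮𝓡 n, 𝓡 n⟯ M) where
  mul f h := h.trans f
  one := Diffeomorph.refl (𝓡 n) M ∞
  inv f := f.symm
  mul_assoc _ _ _ := rfl
  one_mul _ := rfl
  mul_one _ := rfl
  inv_mul_cancel f := Diffeomorph.self_trans_symm f

/-! ### Local formulas

`ℝⁿ × ℝⁿ` carries the coordinates `(x, y)` = (position, velocity) that a chart of `M` induces on
`TM`; `L : ℝⁿ × ℝⁿ → ℝ` stands for a Finsler function written in such coordinates. -/

section Coordinates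

variable {n : ℕ}

/-- The space of the coordinates `x` (and of the coordinates `y`). -/
abbrev Coord (n : ℕ) : Type := EuclideanSpace ℝ (Fin n)

/-- `∂f/∂xⁱ` for a function `f(x, y)`. -/
def pdx (i : Fin n) (f : Coord n × Coord n → ℝ) (z : Coord n × Coord n) : ℝ :=
  fderiv ℝ f z (EuclideanSpace.single i 1, 0)

/-- `∂f/∂yⁱ` for a function `f(x, y)`. -/
def pdy (i : Fin n) (f : Coord n × Coord n → ℝ) (z : Coord n × Coord n) : ℝ :=
  fderiv ℝ f z (0, EuclideanSpace.single i 1)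

/-- `∂u/∂xⁱ` for a function `u(x)`. -/
def pd (i : Fin n) (u : Coord n → ℝ) (x : Coord n) : ℝ :=
  fderiv ℝ u x (EuclideanSpace.single i 1)

/-- The fundamental tensor `g_ij = ½ ∂²(L²)/∂yⁱ∂yʲ`. -/
def gMat (L : Coord n × Coord n → ℝ) (z : Coord n × Coord n) : Matrix (Fin n) (Fin n) ℝ :=
  Matrix.of fun i j => (1 / 2) * pdy i (pdy j fun w => L w ^ 2) z

/-- The inverse matrix `g^{ij}`. -/
def gInv (L : Coord n × Coord n → ℝ) (z : Coord n × Coord n) : Matrix (Fin n) (Fin n) ℝ :=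
  (gMat L z)⁻¹

/-- The spray coefficients `Gⁱ = ¼ g^{il} ([L²]_{xᵏyˡ} yᵏ - [L²]_{xˡ})`. -/
def spray (L : Coord n × Coord n → ℝ) (i : Fin n) (z : Coord n × Coord n) : ℝ :=
  (1 / 4) * ∑ l, gInv L z i l *
    ((∑ k, pdx k (pdy l fun w => L w ^ 2) z * z.2 k) - pdx l (fun w => L w ^ 2) z)

/-- The nonlinear connection `G^i_j = ∂Gⁱ/∂yʲ`. -/
def nonlin (L : Coord n × Coord n → ℝ) (i j : Fin n) (z : Coord n × Coord n) : ℝ :=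
  pdy j (spray L i) z

/-- The horizontal derivative `δf/δxᵏ = ∂f/∂xᵏ - G^j_k ∂f/∂yʲ`. -/
def hor (L : Coord n × Coord n → ℝ) (k : Fin n) (f : Coord n × Coord n → ℝ)
    (z : Coord n × Coord n) : ℝ :=
  pdx k f z - ∑ j, nonlin L j k z * pdy j f z

/-- Horizontal coefficients of the Cartan connection,
`Γ^i_{jk} = ½ g^{il} (δ_j g_{lk} + δ_k g_{jl} - δ_l g_{jk})`. -/
def gam (L : Coord n × Coord n → ℝ) (i j k : Fin n) (z : Coord n × Coord n) : ℝ :=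
  (1 / 2) * ∑ l, gInv L z i l *
    (hor L j (fun w => gMat L w l k) z + hor L k (fun w => gMat L w j l) z
      - hor L l (fun w => gMat L w j k) z)

/-- Vertical coefficients of the Cartan connection (the Cartan tensor),
`C^i_{jk} = ½ g^{il} ∂g_{jk}/∂yˡ`. -/
def cartan (L : Coord n × Coord n → ℝ) (i j k : Fin n) (z : Coord n × Coord n) : ℝ :=
  (1 / 2) * ∑ l, gInv L z i l * pdy l (fun w => gMat L w j k) z

/-- The connection form of the Cartan connection, `ω^i_j = Γ^i_{jk} dxᵏ + C^i_{jk} δyᵏ` with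
`δyᵏ = dyᵏ + G^k_m dxᵐ`, evaluated on the tangent vector
`X = X.1ᵏ ∂/∂xᵏ + X.2ᵏ ∂/∂yᵏ` at the point `z`. -/
def omega (L : Coord n × Coord n → ℝ) (i j : Fin n) (z X : Coord n × Coord n) : ℝ :=
  ∑ k, (gam L i j k z * X.1 k + cartan L i j k z * (X.2 k + ∑ m, nonlin L k m z * X.1 m))

/-- The Hessian of a function `u(x)` for the Cartan connection, `(X Y) u - (∇_X Y) u`, evaluated
for `Y = Yʲ ∂/∂xʲ` with constant coefficients `Yʲ` (it is tensorial in `X` and `Y`). -/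
def hess (L : Coord n × Coord n → ℝ) (u : Coord n → ℝ) (z X : Coord n × Coord n) (Y : Coord n) :
    ℝ :=
  (∑ k, ∑ j, pd k (pd j u) z.1 * X.1 k * Y j) - ∑ i, ∑ j, omega L i j z X * Y j * pd i u z.1

/-- The horizontal Laplacian `g^{ij} (∂²u/∂xⁱ∂xʲ - Γ^k_{ij} ∂u/∂xᵏ)`. -/
def lapH (L : Coord n × Coord n → ℝ) (u : Coord n → ℝ) (z : Coord n × Coord n) : ℝ :=
  ∑ i, ∑ j, gInv L z i j * (pd i (pd j u) z.1 - ∑ k, gam L k i j z * pd k u z.1)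

/-- The vertical Laplacian `g^{ij} (- C^k_{ij} ∂u/∂xᵏ)`. -/
def lapV (L : Coord n × Coord n → ℝ) (u : Coord n → ℝ) (z : Coord n × Coord n) : ℝ :=
  ∑ i, ∑ j, gInv L z i j * (-∑ k, cartan L k i j z * pd k u z.1)

/-- `‖grad u‖² = g^{ij} u_i u_j`. -/
def gradSq (L : Coord n × Coord n → ℝ) (u : Coord n → ℝ) (z : Coord n × Coord n) : ℝ :=
  ∑ i, ∑ j, gInv L z i j * pd i u z.1 * pd j u z.1

/-- The Schwarzian tensor in coordinates, for `X` tangent to `TM` at `z` (with projection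
`ϱX = X.1`) and `Y` in the fibre of `π^*TM` at `z`:
`Hess(u)(X, Y) - du(ϱX) du(Y) - (1/n) (Δu - ‖grad u‖²) g(ϱX, Y)`. -/
def schwarzianLoc (L : Coord n × Coord n → ℝ) (u : Coord n → ℝ) (z X : Coord n × Coord n)
    (Y : Coord n) : ℝ :=
  hess L u z X Y - (∑ i, pd i u z.1 * X.1 i) * (∑ j, pd j u z.1 * Y j)
    - (1 / (n : ℝ)) * ((lapH L u z + lapV L u z) - gradSq L u z)
      * ∑ i, ∑ j, gMat L z i j * X.1 i * Y j

end Coordinates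

/-! ### Finsler structures on manifolds -/

section Manifold

variable {n : ℕ} {M : Type*} [TopologicalSpace M] [ChartedSpace (EuclideanSpace ℝ (Fin n)) M]
  [IsManifold (𝓡 n) ∞ M]

/-- A function on `TM` in the coordinates `(x, y)` of `TM` induced by the preferred chart of `M`
at the base point of `z`. -/
def inChart (F : TangentBundle (𝓡 n) M → ℝ) (z : TangentBundle (𝓡 n) M) :
    Coord n × Coord n → ℝ :=
  fun w => F ((extChartAt (𝓡 n).tangent z).symm w)

/-- The coordinates of `z` in the same chart. -/
def coordAt (z : TangentBundle (𝓡 n) M) : Coord n × Coord n :=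
  extChartAt (𝓡 n).tangent z z

variable (n M) in
/-- A Finsler structure on the `n`-dimensional manifold `M`. -/
structure FinslerStructure where
  /-- The Finsler function `F : TM → [0, ∞)`. -/
  toFun : TangentBundle (𝓡 n) M → ℝ
  nonneg : ∀ z, 0 ≤ toFun z
  smooth : ContMDiffOn (𝓡 n).tangent 𝓘(ℝ, ℝ) ∞ toFun {z | z.2 ≠ 0}
  homogeneous : ∀ (x : M) (y : TangentSpace (𝓡 n) x) (c : ℝ), 0 < c →
    toFun ⟨x, c • y⟩ = c * toFun ⟨x, y⟩
  posDef : ∀ z : TangentBundle (𝓡 n) M, z.2 ≠ 0 → (gMat (inChart toFun z) (coordAt z)).PosDef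

/-- The Schwarzian tensor `B_F(φ)` at the point `z` of `TM₀`. The spaces `T_z(TM)` and `T_xM` are
identified with `ℝⁿ × ℝⁿ` and `ℝⁿ` by the same chart in which the local formula is evaluated
(this is how the tangent spaces are defined in Mathlib). -/
def schwarzian (F : FinslerStructure n M) (φ : M → ℝ) (z : TangentBundle (𝓡 n) M)
    (X : TangentSpace (𝓡 n).tangent z) (Y : TangentSpace (𝓡 n) z.proj) : ℝ :=
  schwarzianLoc (inChart F.toFun z) (φ ∘ (extChartAt (𝓡 n) z.proj).symm) (coordAt z) X Y

/-- `f` is conformal with conformal factor `φ`: `φ` is a smooth function on `M` and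
`f^*F = e^φ F`. -/
def IsConformalWith (F : FinslerStructure n M) (f : M ≃ₘ⟮𝓡 n, 𝓡 n⟯ M) (φ : M → ℝ) : Prop :=
  ContMDiff (𝓡 n) 𝓘(ℝ, ℝ) ∞ φ ∧
    ∀ z : TangentBundle (𝓡 n) M,
      F.toFun (tangentMap (𝓡 n) (𝓡 n) f z) = Real.exp (φ z.proj) * F.toFun z

/-- `f` is a conformal transformation of `(M, F)`. -/
def IsConformal (F : FinslerStructure n M) (f : M ≃ₘ⟮𝓡 n, 𝓡 n⟯ M) : Prop :=
  ∃ φ : M → ℝ, IsConformalWith F f φ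

/-- `f` is a homothety of `(M, F)`: the conformal factor is constant. -/
def IsHomothety (F : FinslerStructure n M) (f : M ≃ₘ⟮𝓡 n, 𝓡 n⟯ M) : Prop :=
  ∃ c : ℝ, IsConformalWith F f fun _ => c

/-- `f` is a Möbius transformation of `(M, F)`: it is conformal, and the Schwarzian tensor of its
conformal factor vanishes at every point of `TM₀`, on all tangent vectors of `TM₀`. -/
def IsMobius (F : FinslerStructure n M) (f : M ≃ₘ⟮𝓡 n, 𝓡 n⟯ M) : Prop :=
  ∃ φ : M → ℝ, IsConformalWith F f φ ∧
    ∀ z : TangentBundle (𝓡 n) M, z.2 ≠ 0 →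
      ∀ (X : TangentSpace (𝓡 n).tangent z) (Y : TangentSpace (𝓡 n) z.proj),
        schwarzian F φ z X Y = 0

end Manifold

end Finsler

end

open scoped Manifold ContDiff

noncomputable section

namespace Finsler

lemma two_le_smooth : (2 : WithTop ℕ∞) ≤ ∞ :=
  WithTop.coe_le_coe.2 (le_top : (2 : ℕ∞) ≤ ⊤)

section Fibre

variable {E : Type*} [NormedAddCommGroup E] [NormedSpace ℝ E]

lemma fderiv_fderiv_smul_of_homogeneous {e : E → ℝ}
    (hom : ∀ y, ∀ c : ℝ, 0 < c → e (c • y) = c ^ 2 * e y) {c : ℝ} (hc : 0 < c) (y : E) :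
    fderiv ℝ (fderiv ℝ e) (c • y) = fderiv ℝ (fderiv ℝ e) y := by
  have h1 : ∀ x, fderiv ℝ e (c • x) = c • fderiv ℝ e x := by
    intro x
    have h := fderiv_comp_smul (f := e) (x := x) c
    have h2 : (fun x => e (c • x)) = (c ^ 2) • e := by
      funext x; simp [hom x c hc]
    rw [h2, fderiv_const_smul_field, Pi.smul_apply] at h
    have h3 := congrArg (fun t => c⁻¹ • t) h
    simp only [smul_smul, inv_mul_cancel₀ hc.ne', one_smul] at h3
    rw [← h3]
    congr 1
    field_simp
  have h := fderiv_comp_smul (f := fderiv ℝ e) (x := y) c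
  have h2 : (fun x => fderiv ℝ e (c • x)) = c • fderiv ℝ e := funext h1
  rw [h2, fderiv_const_smul_field (𝕜 := ℝ) (f := fderiv ℝ e) c, Pi.smul_apply] at h
  exact ((smul_right_injective _ hc.ne') h).symm

/-- The third derivative of a `2`-homogeneous function vanishes in the radial direction. -/
lemma fderiv_hessian_apply_self {e : E → ℝ}
    (hom : ∀ y, ∀ c : ℝ, 0 < c → e (c • y) = c ^ 2 * e y) {y : E}
    (he : ContDiffAt ℝ ∞ e y) :
    fderiv ℝ (fderiv ℝ (fderiv ℝ e)) y y = 0 := by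
  have h2 : ContDiffAt ℝ ∞ (fderiv ℝ (fderiv ℝ e)) y :=
    (he.fderiv_right (m := ∞) (by simp)).fderiv_right (by simp)
  have hd : HasFDerivAt (fderiv ℝ (fderiv ℝ e)) (fderiv ℝ (fderiv ℝ (fderiv ℝ e)) y) y :=
    (h2.differentiableAt (by simp)).hasFDerivAt
  have hs : HasDerivAt (fun c : ℝ => c • y) y 1 := by
    simpa using (hasDerivAt_id (1 : ℝ)).smul_const y
  have hd' : HasFDerivAt (fderiv ℝ (fderiv ℝ e)) (fderiv ℝ (fderiv ℝ (fderiv ℝ e)) y)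
      ((1 : ℝ) • y) := by simpa using hd
  have hc := HasFDerivAt.comp_hasDerivAt (l := fderiv ℝ (fderiv ℝ e))
    (l' := fderiv ℝ (fderiv ℝ (fderiv ℝ e)) y) (1 : ℝ) hd' hs
  have hk : HasDerivAt (fderiv ℝ (fderiv ℝ e) ∘ fun c : ℝ => c • y) 0 1 := by
    refine (hasDerivAt_const (1 : ℝ) (fderiv ℝ (fderiv ℝ e) y)).congr_of_eventuallyEq ?_
    filter_upwards [lt_mem_nhds (zero_lt_one (α := ℝ))] with c hc
    exact fderiv_fderiv_smul_of_homogeneous hom hc y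
  exact hc.unique hk

variable [FiniteDimensional ℝ E]

/-- An injective continuous linear map to the dual is a continuous linear equivalence. -/
lemma exists_continuousLinearEquiv_dual (B : E →L[ℝ] E →L[ℝ] ℝ) (hB : ∀ X, X ≠ 0 → 0 < B X X) :
    ∃ A : E ≃L[ℝ] (E →L[ℝ] ℝ), (A : E →L[ℝ] E →L[ℝ] ℝ) = B := by
  have hinj : Function.Injective (B : E →ₗ[ℝ] (E →L[ℝ] ℝ)) := by
    rw [injective_iff_map_eq_zero]
    intro X hX
    by_contra h
    have h2 := hB X h
    have hX' : B X = 0 := hX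
    simp [hX'] at h2
  have hr : Module.finrank ℝ E = Module.finrank ℝ (E →L[ℝ] ℝ) := by
    rw [← (LinearMap.toContinuousLinearMap : (E →ₗ[ℝ] ℝ) ≃ₗ[ℝ] (E →L[ℝ] ℝ)).finrank_eq]
    exact (Subspace.dual_finrank_eq (K := ℝ) (V := E)).symm
  refine ⟨(LinearMap.linearEquivOfInjective _ hinj hr).toContinuousLinearEquiv, ?_⟩
  ext X Y
  rfl

/-- The third derivative vanishes on the half-space where `p` is positive: there the vector dual
to `p` is constant, and the Hessian is constant in its direction and radially. -/
lemma fderiv_hessian_eq_zero_of_pos {e : E → ℝ} (he : ∀ y, y ≠ 0 → ContDiffAt ℝ ∞ e y)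
    (hom : ∀ y, ∀ c : ℝ, 0 < c → e (c • y) = c ^ 2 * e y)
    (pos : ∀ y, y ≠ 0 → ∀ X, X ≠ 0 → 0 < fderiv ℝ (fderiv ℝ e) y X X)
    {p : E →L[ℝ] ℝ}
    (hC : ∀ y, y ≠ 0 → ∀ V, fderiv ℝ (fderiv ℝ e) y V = p →
      fderiv ℝ (fderiv ℝ (fderiv ℝ e)) y V = 0)
    {y : E} (hy : 0 < p y) : fderiv ℝ (fderiv ℝ (fderiv ℝ e)) y = 0 := by
  set H := fderiv ℝ (fderiv ℝ e) with hH
  set S : Set E := {y | 0 < p y} with hS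
  have hSo : IsOpen S := isOpen_lt continuous_const p.continuous
  have hSc : Convex ℝ S := by
    have := (convex_Ioi (0 : ℝ)).linear_preimage (p : E →ₗ[ℝ] ℝ)
    exact this
  have hS0 : ∀ y ∈ S, y ≠ 0 := by
    rintro y hy rfl
    simp [hS] at hy
  have h2 : ∀ y ∈ S, ContDiffAt ℝ ∞ H y := fun y hy =>
    ((he y (hS0 y hy)).fderiv_right (m := ∞) (by simp)).fderiv_right (by simp)
  have hd : ∀ y ∈ S, HasFDerivAt H (fderiv ℝ H y) y := fun y hy =>
    ((h2 y hy).differentiableAt (by simp)).hasFDerivAt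
  set V : E → E := fun y => (H y).inverse p with hV
  have hHV : ∀ y ∈ S, H y (V y) = p := by
    intro y hy
    obtain ⟨A, hA⟩ := exists_continuousLinearEquiv_dual (H y) (pos y (hS0 y hy))
    simp only [hV]
    rw [← hA, ContinuousLinearMap.inverse_equiv]
    simp
  have hVd : ∀ y ∈ S, DifferentiableAt ℝ V y := by
    intro y hy
    obtain ⟨A, hA⟩ := exists_continuousLinearEquiv_dual (H y) (pos y (hS0 y hy))
    have hi : ContDiffAt ℝ 1 ContinuousLinearMap.inverse (H y) := by
      rw [← hA]; exact contDiffAt_map_inverse A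
    have hi2 : DifferentiableAt ℝ (fun y => (H y).inverse) y :=
      (hi.differentiableAt (by simp)).comp y ((h2 y hy).differentiableAt (by simp))
    exact hi2.clm_apply (differentiableAt_const p)
  have hVz : Set.EqOn (fderiv ℝ V) 0 S := by
    intro y hy
    have h3 := (hd y hy).clm_apply (hVd y hy).hasFDerivAt
    have h4 : HasFDerivAt (fun y => H y (V y)) (0 : E →L[ℝ] E →L[ℝ] ℝ) y := by
      refine (hasFDerivAt_const p y).congr_of_eventuallyEq ?_
      filter_upwards [hSo.mem_nhds hy] with w hw using hHV w hw
    have h5 := h3.unique h4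
    have hsym : IsSymmSndFDerivAt ℝ (fderiv ℝ e) y :=
      ((he y (hS0 y hy)).fderiv_right (m := ∞) (by simp)).isSymmSndFDerivAt
        (by simpa using two_le_smooth)
    ext1 Z
    have h6 := congrArg (fun t => t Z) h5
    simp only [add_apply, ContinuousLinearMap.comp_apply,
      ContinuousLinearMap.flip_apply, zero_apply] at h6
    have h7 : fderiv ℝ H y Z (V y) = 0 := by
      rw [hsym.eq Z (V y)]
      have := hC y (hS0 y hy) (V y) (hHV y hy)
      rw [this]; rfl
    rw [h7, add_zero] at h6
    by_contra hne
    have := pos y (hS0 y hy) _ hne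
    rw [h6] at this
    simp at this
  have hconst : ∀ w ∈ S, V w = V y := fun w hw =>
    hSo.is_const_of_fderiv_eq_zero hSc.isPreconnected
      (fun x hx => (hVd x hx).differentiableWithinAt) hVz hw hy
  have hyS : y ∈ S := hy
  have hp0 : V y ≠ 0 := by
    intro h
    have := hHV y hyS
    rw [h, map_zero] at this
    rw [← this] at hy
    simp at hy
  have hVS : V y ∈ S := by
    have h3 := pos y (hS0 y hyS) (V y) hp0
    rw [hHV y hyS] at h3
    exact h3
  have hHc : ∀ w ∈ S, H w = H (V y) := by
    intro w hw
    set γ : ℝ → E := fun t => (1 - t) • w + t • V y with hγ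
    have hγS : ∀ t ∈ Set.Icc (0 : ℝ) 1, γ t ∈ S := by
      intro t ht
      exact hSc hw hVS (by linarith [ht.2]) ht.1 (by ring)
    have hγd : ∀ t, HasDerivAt γ (V y - w) t := by
      intro t
      have h3 := (((hasDerivAt_const t (1 : ℝ)).sub (hasDerivAt_id t)).smul_const w).add
        ((hasDerivAt_id t).smul_const (V y))
      refine h3.congr_deriv ?_
      simp; abel
    have h4 := constant_of_has_deriv_right_zero (f := fun t => H (γ t)) (a := 0) (b := 1) ?_ ?_ 1
      (by simp)
    · simp [hγ] at h4
      exact h4.symm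
    · intro t ht
      exact ((hd _ (hγS t ht)).continuousAt.comp (hγd t).continuousAt).continuousWithinAt
    · intro t ht
      have htS := hγS t ⟨ht.1, ht.2.le⟩
      have h5 := HasFDerivAt.comp_hasDerivAt (l := H) (l' := fderiv ℝ H (γ t)) t (hd _ htS) (hγd t)
      have h6 : fderiv ℝ H (γ t) (V y - w) = 0 := by
        have h7 : fderiv ℝ H (γ t) (V y) = 0 := by
          rw [← hconst _ htS]
          exact hC _ (hS0 _ htS) _ (hHV _ htS)
        have h8 : fderiv ℝ H (γ t) (γ t) = 0 :=
          fderiv_hessian_apply_self hom (he _ (hS0 _ htS))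
        have h9 : (1 - t) • fderiv ℝ H (γ t) w = 0 := by
          rw [show γ t = (1 - t) • w + t • V y from rfl] at h8 h7 ⊢
          rw [map_add, map_smul, map_smul, h7, smul_zero, add_zero] at h8
          exact h8
        have h10 : (1 - t) ≠ 0 := by linarith [ht.2]
        rw [map_sub, h7, (smul_eq_zero.mp h9).resolve_left h10, sub_zero]
      rw [h6] at h5
      exact h5.hasDerivWithinAt
  have h11 : HasFDerivAt H (0 : E →L[ℝ] E →L[ℝ] E →L[ℝ] ℝ) y := by
    refine (hasFDerivAt_const (H (V y)) y).congr_of_eventuallyEq ?_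
    filter_upwards [hSo.mem_nhds hyS] with w hw using hHc w hw
  exact h11.fderiv

/-- Let `e` be a `2`-homogeneous function, smooth with positive definite Hessian off the origin.
If the third derivative vanishes in the direction dual to a fixed covector `p ≠ 0`, it vanishes. -/
theorem fderiv_hessian_eq_zero {e : E → ℝ} (he : ∀ y, y ≠ 0 → ContDiffAt ℝ ∞ e y)
    (hom : ∀ y, ∀ c : ℝ, 0 < c → e (c • y) = c ^ 2 * e y)
    (pos : ∀ y, y ≠ 0 → ∀ X, X ≠ 0 → 0 < fderiv ℝ (fderiv ℝ e) y X X)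
    {p : E →L[ℝ] ℝ} (hp : p ≠ 0)
    (hC : ∀ y, y ≠ 0 → ∀ V, fderiv ℝ (fderiv ℝ e) y V = p →
      fderiv ℝ (fderiv ℝ (fderiv ℝ e)) y V = 0)
    {y : E} (hy : y ≠ 0) : fderiv ℝ (fderiv ℝ (fderiv ℝ e)) y = 0 := by
  rcases lt_trichotomy (p y) 0 with h | h | h
  · refine fderiv_hessian_eq_zero_of_pos he hom pos (p := -p) ?_ (by simpa using h)
    intro y hy V hV
    have := hC y hy (-V) (by rw [map_neg, hV, neg_neg])
    simpa using this
  · obtain ⟨v, hv⟩ : ∃ v, 0 < p v := by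
      obtain ⟨v, hv⟩ : ∃ v, p v ≠ 0 := by
        by_contra! hcon
        exact hp (ContinuousLinearMap.ext hcon)
      rcases lt_or_gt_of_ne hv with h1 | h1
      · exact ⟨-v, by simpa using h1⟩
      · exact ⟨v, h1⟩
    have hcont : ContinuousAt (fderiv ℝ (fderiv ℝ (fderiv ℝ e))) y :=
      ((((he y hy).fderiv_right (m := ∞) (by simp)).fderiv_right (m := ∞) (by simp)).fderiv_right
        (m := ∞) (by simp)).continuousAt
    have hlin : Filter.Tendsto (fun t : ℝ => y + t • v) (nhdsWithin 0 (Set.Ioi 0)) (nhds y) := by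
      have : Continuous fun t : ℝ => y + t • v := by fun_prop
      have h2 := this.tendsto 0
      simp only [zero_smul, add_zero] at h2
      exact h2.mono_left nhdsWithin_le_nhds
    have h3 := hcont.tendsto.comp hlin
    refine tendsto_nhds_unique h3 (tendsto_const_nhds.congr' ?_)
    filter_upwards [self_mem_nhdsWithin] with t ht
    refine (fderiv_hessian_eq_zero_of_pos he hom pos hC ?_).symm
    simpa [h] using mul_pos ht hv
  · exact fderiv_hessian_eq_zero_of_pos he hom pos hC h

end Fibre

section LocalForms

variable {n : ℕ}

/-- The vector `eᵢ` of the standard basis. -/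
abbrev stdVec (i : Fin n) : Coord n := EuclideanSpace.single i 1

lemma map_eq_sum_stdVec {G : Type*} [NormedAddCommGroup G] [NormedSpace ℝ G]
    (A : Coord n →L[ℝ] G) (X : Coord n) : A X = ∑ i, X i • A (stdVec i) := by
  have h : X = ∑ i, X i • stdVec i := by
    ext j
    simp [Finset.sum_apply, Pi.single_apply]
  conv_lhs => rw [h]
  simp

/-- The fundamental tensor as a bilinear form, for `Q = L²`. -/
def metricForm (Q : Coord n × Coord n → ℝ) (z : Coord n × Coord n) (X Y : Coord n) : ℝ :=
  (1 / 2) * fderiv ℝ (fderiv ℝ Q) z (0, X) (0, Y)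

/-- The derivative of the fundamental tensor in the direction `A`. -/
def metricDeriv (Q : Coord n × Coord n → ℝ) (z A : Coord n × Coord n) (X Y : Coord n) : ℝ :=
  (1 / 2) * fderiv ℝ (fderiv ℝ (fderiv ℝ Q)) z A (0, X) (0, Y)

/-- The Christoffel symbols of the first kind, for horizontal derivatives along `∂/∂x`. -/
def christoffel (Q : Coord n × Coord n → ℝ) (z : Coord n × Coord n) (X Y Z : Coord n) : ℝ :=
  (1 / 2) * (metricDeriv Q z (X, 0) Z Y + metricDeriv Q z (Y, 0) X Z
    - metricDeriv Q z (Z, 0) X Y)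

variable {L Q : Coord n × Coord n → ℝ} {z : Coord n × Coord n}

lemma hasFDerivAt_fderiv_apply {E : Type*} [NormedAddCommGroup E] [NormedSpace ℝ E] {Q : E → ℝ}
    {z : E} (hQ : ContDiffAt ℝ 2 Q z) (a : E) :
    HasFDerivAt (fun w => fderiv ℝ Q w a) ((fderiv ℝ (fderiv ℝ Q) z).flip a) z := by
  have h : HasFDerivAt (fderiv ℝ Q) (fderiv ℝ (fderiv ℝ Q) z) z :=
    ((hQ.fderiv_right (m := 1) (by norm_num)).differentiableAt (by simp)).hasFDerivAt
  simpa using h.clm_apply (hasFDerivAt_const a z)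

lemma fderiv_fderiv_apply {E : Type*} [NormedAddCommGroup E] [NormedSpace ℝ E] {Q : E → ℝ}
    {z : E} (hQ : ContDiffAt ℝ 2 Q z) (a b : E) :
    fderiv ℝ (fun w => fderiv ℝ Q w a) z b = fderiv ℝ (fderiv ℝ Q) z b a := by
  rw [(hasFDerivAt_fderiv_apply hQ a).fderiv]
  rfl

lemma hasFDerivAt_hessian_apply {E : Type*} [NormedAddCommGroup E] [NormedSpace ℝ E] {Q : E → ℝ}
    {z : E} (hQ : ContDiffAt ℝ 3 Q z) (a b : E) :
    HasFDerivAt (fun w => fderiv ℝ (fderiv ℝ Q) w a b)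
      (((fderiv ℝ (fderiv ℝ (fderiv ℝ Q)) z).flip a).flip b) z := by
  have h : HasFDerivAt (fderiv ℝ (fderiv ℝ Q)) (fderiv ℝ (fderiv ℝ (fderiv ℝ Q)) z) z :=
    (((hQ.fderiv_right (m := 2) (by norm_num)).fderiv_right (m := 1)
      (by norm_num)).differentiableAt (by simp)).hasFDerivAt
  have h2 := (h.clm_apply (hasFDerivAt_const a z)).clm_apply (hasFDerivAt_const b z)
  simpa using h2

lemma gMat_eq_metricForm (hQ : ContDiffAt ℝ 2 (fun w => L w ^ 2) z) (i j : Fin n) :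
    gMat L z i j = metricForm (fun w => L w ^ 2) z (stdVec i) (stdVec j) := by
  simp only [gMat, Matrix.of_apply, metricForm]
  congr 1
  exact fderiv_fderiv_apply hQ _ _

lemma fderiv_metricForm (hQ : ContDiffAt ℝ 3 Q z) (A : Coord n × Coord n) (X Y : Coord n) :
    fderiv ℝ (fun w => metricForm Q w X Y) z A = metricDeriv Q z A X Y := by
  have h := (hasFDerivAt_hessian_apply hQ ((0 : Coord n), X) ((0 : Coord n), Y)).const_mul (1 / 2)
  simp only [metricForm, metricDeriv]
  rw [h.fderiv]
  rfl

lemma fderiv_gMat (hQ : ContDiffAt ℝ ∞ (fun w => L w ^ 2) z) (A : Coord n × Coord n)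
    (i j : Fin n) :
    fderiv ℝ (fun w => gMat L w i j) z A
      = metricDeriv (fun w => L w ^ 2) z A (stdVec i) (stdVec j) := by
  have h2 : ContDiffAt ℝ 2 (fun w => L w ^ 2) z := hQ.of_le two_le_smooth
  have h3 : ContDiffAt ℝ 3 (fun w => L w ^ 2) z :=
    hQ.of_le (WithTop.coe_le_coe.2 (le_top : (3 : ℕ∞) ≤ ⊤))
  rw [← fderiv_metricForm h3]
  have he : (fun w => gMat L w i j)
      =ᶠ[nhds z] fun w => metricForm (fun w => L w ^ 2) w (stdVec i) (stdVec j) := by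
    filter_upwards [h2.eventually (by simp)] with w hw using gMat_eq_metricForm hw i j
  rw [he.fderiv_eq]

lemma bilinear_eq_sum {f : Coord n → Coord n → ℝ}
    (h1 : ∀ X X' Y, f (X + X') Y = f X Y + f X' Y) (h2 : ∀ (c : ℝ) X Y, f (c • X) Y = c * f X Y)
    (h3 : ∀ X Y Y', f X (Y + Y') = f X Y + f X Y') (h4 : ∀ (c : ℝ) X Y, f X (c • Y) = c * f X Y)
    (X Y : Coord n) : f X Y = ∑ i, ∑ j, f (stdVec i) (stdVec j) * X i * Y j := by
  let B : Coord n →ₗ[ℝ] Coord n →ₗ[ℝ] ℝ := LinearMap.mk₂ ℝ f h1 h2 h3 h4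
  have hX := map_eq_sum_stdVec (LinearMap.toContinuousLinearMap (B.flip Y)) X
  have hY : ∀ i, f (stdVec i) Y = ∑ j, Y j * f (stdVec i) (stdVec j) := fun i => by
    simpa [B] using map_eq_sum_stdVec (LinearMap.toContinuousLinearMap (B (stdVec i))) Y
  have hX' : f X Y = ∑ i, X i * f (stdVec i) Y := by simpa [B] using hX
  rw [hX']
  refine Finset.sum_congr rfl fun i _ => ?_
  rw [hY, Finset.mul_sum]
  refine Finset.sum_congr rfl fun j _ => ?_
  ring

lemma inr_add (X Y : Coord n) : ((0 : Coord n), X + Y) = (0, X) + (0, Y) := by simp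

lemma inl_add (X Y : Coord n) : (X + Y, (0 : Coord n)) = (X, 0) + (Y, 0) := by simp

lemma inr_smul (c : ℝ) (X : Coord n) : ((0 : Coord n), c • X) = c • ((0 : Coord n), X) := by simp

lemma inl_smul (c : ℝ) (X : Coord n) : (c • X, (0 : Coord n)) = c • (X, (0 : Coord n)) := by simp

lemma metricForm_add_left (X X' Y : Coord n) :
    metricForm Q z (X + X') Y = metricForm Q z X Y + metricForm Q z X' Y := by
  simp only [metricForm, inr_add, map_add, add_apply]; ring

lemma metricForm_smul_left (c : ℝ) (X Y : Coord n) :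
    metricForm Q z (c • X) Y = c * metricForm Q z X Y := by
  simp only [metricForm, inr_smul, map_smul, smul_apply, smul_eq_mul]; ring

lemma metricForm_add_right (X Y Y' : Coord n) :
    metricForm Q z X (Y + Y') = metricForm Q z X Y + metricForm Q z X Y' := by
  simp only [metricForm, inr_add, map_add]; ring

lemma metricForm_smul_right (c : ℝ) (X Y : Coord n) :
    metricForm Q z X (c • Y) = c * metricForm Q z X Y := by
  simp only [metricForm, inr_smul, map_smul, smul_eq_mul]; ring

lemma metricDeriv_add_left (A : Coord n × Coord n) (X X' Y : Coord n) :
    metricDeriv Q z A (X + X') Y = metricDeriv Q z A X Y + metricDeriv Q z A X' Y := by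
  simp only [metricDeriv, inr_add, map_add, add_apply]; ring

lemma metricDeriv_smul_left (A : Coord n × Coord n) (c : ℝ) (X Y : Coord n) :
    metricDeriv Q z A (c • X) Y = c * metricDeriv Q z A X Y := by
  simp only [metricDeriv, inr_smul, map_smul, smul_apply, smul_eq_mul]; ring

lemma metricDeriv_add_right (A : Coord n × Coord n) (X Y Y' : Coord n) :
    metricDeriv Q z A X (Y + Y') = metricDeriv Q z A X Y + metricDeriv Q z A X Y' := by
  simp only [metricDeriv, inr_add, map_add]; ring

lemma metricDeriv_smul_right (A : Coord n × Coord n) (c : ℝ) (X Y : Coord n) :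
    metricDeriv Q z A X (c • Y) = c * metricDeriv Q z A X Y := by
  simp only [metricDeriv, inr_smul, map_smul, smul_eq_mul]; ring

lemma metricDeriv_add_dir (A B : Coord n × Coord n) (X Y : Coord n) :
    metricDeriv Q z (A + B) X Y = metricDeriv Q z A X Y + metricDeriv Q z B X Y := by
  simp only [metricDeriv, map_add, add_apply]; ring

lemma metricDeriv_smul_dir (c : ℝ) (A : Coord n × Coord n) (X Y : Coord n) :
    metricDeriv Q z (c • A) X Y = c * metricDeriv Q z A X Y := by
  simp only [metricDeriv, map_smul, smul_apply, smul_eq_mul]; ring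

lemma metricForm_eq_sum (X Y : Coord n) :
    metricForm Q z X Y = ∑ i, ∑ j, metricForm Q z (stdVec i) (stdVec j) * X i * Y j :=
  bilinear_eq_sum metricForm_add_left metricForm_smul_left metricForm_add_right
    metricForm_smul_right X Y

lemma christoffel_add_left (X X' Y Z : Coord n) :
    christoffel Q z (X + X') Y Z = christoffel Q z X Y Z + christoffel Q z X' Y Z := by
  simp only [christoffel, inl_add, metricDeriv_add_dir, metricDeriv_add_left]; ring

lemma christoffel_smul_left (c : ℝ) (X Y Z : Coord n) :
    christoffel Q z (c • X) Y Z = c * christoffel Q z X Y Z := by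
  simp only [christoffel, inl_smul, metricDeriv_smul_dir, metricDeriv_smul_left]; ring

lemma christoffel_add_mid (X Y Y' Z : Coord n) :
    christoffel Q z X (Y + Y') Z = christoffel Q z X Y Z + christoffel Q z X Y' Z := by
  simp only [christoffel, inl_add, metricDeriv_add_dir, metricDeriv_add_right]; ring

lemma christoffel_smul_mid (c : ℝ) (X Y Z : Coord n) :
    christoffel Q z X (c • Y) Z = c * christoffel Q z X Y Z := by
  simp only [christoffel, inl_smul, metricDeriv_smul_dir, metricDeriv_smul_right]; ring

lemma christoffel_add_right (X Y Z Z' : Coord n) :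
    christoffel Q z X Y (Z + Z') = christoffel Q z X Y Z + christoffel Q z X Y Z' := by
  simp only [christoffel, inl_add, metricDeriv_add_dir, metricDeriv_add_left,
    metricDeriv_add_right]; ring

lemma christoffel_smul_right (c : ℝ) (X Y Z : Coord n) :
    christoffel Q z X Y (c • Z) = c * christoffel Q z X Y Z := by
  simp only [christoffel, inl_smul, metricDeriv_smul_dir, metricDeriv_smul_left,
    metricDeriv_smul_right]; ring

lemma linear_eq_sum {f : Coord n → ℝ} (h1 : ∀ X Y, f (X + Y) = f X + f Y)
    (h2 : ∀ (c : ℝ) X, f (c • X) = c * f X) (X : Coord n) : f X = ∑ i, X i * f (stdVec i) := by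
  let B : Coord n →ₗ[ℝ] ℝ := { toFun := f, map_add' := h1, map_smul' := h2 }
  simpa [B] using map_eq_sum_stdVec (LinearMap.toContinuousLinearMap B) X

/-! ### Vanishing of the Schwarzian tensor -/

lemma gInv_comm (hg : (gMat L z).PosDef) (i j : Fin n) : gInv L z i j = gInv L z j i := by
  have h := hg.isHermitian.inv
  have h2 := congrFun (congrFun h.eq i) j
  simpa [Matrix.conjTranspose_apply, gInv] using h2.symm

lemma gMat_comm (hg : (gMat L z).PosDef) (i j : Fin n) : gMat L z i j = gMat L z j i := by
  have h2 := congrFun (congrFun hg.isHermitian.eq i) j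
  simpa [Matrix.conjTranspose_apply] using h2.symm

lemma gInv_mul_gMat (hg : (gMat L z).PosDef) : gInv L z * gMat L z = 1 :=
  Matrix.nonsing_inv_mul _ ((Matrix.isUnit_iff_isUnit_det _).1 hg.isUnit)

/-- `u_{kj} - Γⁱ_{jk} uᵢ - u_k u_j`. -/
def schwarzianCoeff (L : Coord n × Coord n → ℝ) (u : Coord n → ℝ) (z : Coord n × Coord n)
    (k j : Fin n) : ℝ :=
  pd k (pd j u) z.1 - ∑ i, gam L i j k z * pd i u z.1 - pd k u z.1 * pd j u z.1

lemma schwarzianLoc_eq {u : Coord n → ℝ} (hg : (gMat L z).PosDef)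
    (hC : ∀ j k, ∑ i, cartan L i j k z * pd i u z.1 = 0) (X : Coord n × Coord n) (Y : Coord n) :
    schwarzianLoc L u z X Y = (∑ k, ∑ j, schwarzianCoeff L u z k j * X.1 k * Y j)
      - (1 / (n : ℝ)) * (∑ i, ∑ j, gInv L z i j * schwarzianCoeff L u z i j)
        * ∑ i, ∑ j, gMat L z i j * X.1 i * Y j := by
  have hV : lapV L u z = 0 := by
    simp [lapV, hC]
  have hω : ∀ j, ∑ i, omega L i j z X * pd i u z.1
      = ∑ k, (∑ i, gam L i j k z * pd i u z.1) * X.1 k := by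
    intro j
    simp only [omega, Finset.sum_mul]
    rw [Finset.sum_comm]
    refine Finset.sum_congr rfl fun k _ => ?_
    have : ∑ i, (gam L i j k z * X.1 k
          + cartan L i j k z * (X.2 k + ∑ m, nonlin L k m z * X.1 m)) * pd i u z.1
        = (∑ i, gam L i j k z * pd i u z.1) * X.1 k
          + (∑ i, cartan L i j k z * pd i u z.1) * (X.2 k + ∑ m, nonlin L k m z * X.1 m) := by
      rw [Finset.sum_mul, Finset.sum_mul, ← Finset.sum_add_distrib]
      exact Finset.sum_congr rfl fun i _ => by ring
    rw [this, hC, zero_mul, add_zero, Finset.sum_mul]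
  have hH : hess L u z X Y
      = ∑ k, ∑ j, (pd k (pd j u) z.1 - ∑ i, gam L i j k z * pd i u z.1) * X.1 k * Y j := by
    have h1 : ∑ i, ∑ j, omega L i j z X * Y j * pd i u z.1
        = ∑ k, ∑ j, (∑ i, gam L i j k z * pd i u z.1) * X.1 k * Y j := by
      rw [Finset.sum_comm]
      rw [Finset.sum_comm (f := fun k j => (∑ i, gam L i j k z * pd i u z.1) * X.1 k * Y j)]
      refine Finset.sum_congr rfl fun j _ => ?_
      rw [← Finset.sum_mul, ← hω, Finset.sum_mul]
      exact Finset.sum_congr rfl fun i _ => by ring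
    simp only [hess, h1, ← Finset.sum_sub_distrib, sub_mul]
  have hL : lapH L u z - gradSq L u z
      = ∑ i, ∑ j, gInv L z i j * schwarzianCoeff L u z i j := by
    have h1 : ∑ i, ∑ j, gInv L z i j * ∑ k, gam L k i j z * pd k u z.1
        = ∑ i, ∑ j, gInv L z i j * ∑ k, gam L k j i z * pd k u z.1 := by
      rw [Finset.sum_comm]
      refine Finset.sum_congr rfl fun i _ => Finset.sum_congr rfl fun j _ => ?_
      rw [gInv_comm hg]
    simp only [lapH, gradSq, schwarzianCoeff, mul_sub, Finset.sum_sub_distrib, h1, mul_assoc]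
  have hd : (∑ i, pd i u z.1 * X.1 i) * (∑ j, pd j u z.1 * Y j)
      = ∑ k, ∑ j, pd k u z.1 * pd j u z.1 * X.1 k * Y j := by
    rw [Finset.sum_mul_sum]
    exact Finset.sum_congr rfl fun i _ => Finset.sum_congr rfl fun j _ => by ring
  rw [schwarzianLoc, hV, add_zero, hL, hH, hd]
  simp only [← Finset.sum_sub_distrib, schwarzianCoeff, sub_mul]

lemma cartan_contraction_eq_zero {u : Coord n → ℝ}
    (h : ∀ X Y, schwarzianLoc L u z X Y = 0) (j k : Fin n) :
    ∑ i, cartan L i j k z * pd i u z.1 = 0 := by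
  have := h (0, stdVec k) (stdVec j)
  simpa [schwarzianLoc, hess, omega, Pi.single_apply] using this

/-- The Schwarzian tensor vanishes iff the Cartan tensor kills `du` and `Hess u - du ⊗ du` is
pointwise proportional to the metric. -/
lemma schwarzianLoc_eq_zero_iff {u : Coord n → ℝ} (hn : 0 < n) (hg : (gMat L z).PosDef) :
    (∀ X Y, schwarzianLoc L u z X Y = 0) ↔
      (∀ j k, ∑ i, cartan L i j k z * pd i u z.1 = 0) ∧
      ∃ c : ℝ, ∀ k j, schwarzianCoeff L u z k j = c * gMat L z k j := by
  constructor
  · intro h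
    have hC := cartan_contraction_eq_zero h
    refine ⟨hC, (1 / (n : ℝ)) * ∑ i, ∑ j, gInv L z i j * schwarzianCoeff L u z i j, ?_⟩
    intro k j
    have := h (stdVec k, 0) (stdVec j)
    rw [schwarzianLoc_eq hg hC] at this
    simp at this
    simp
    linarith
  · rintro ⟨hC, c, hc⟩ X Y
    rw [schwarzianLoc_eq hg hC]
    have h1 : ∑ i, ∑ j, gInv L z i j * schwarzianCoeff L u z i j = c * n := by
      have h2 : (gInv L z * gMat L z).trace = n := by
        rw [gInv_mul_gMat hg]; simp
      rw [← h2, Matrix.trace, Finset.mul_sum]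
      refine Finset.sum_congr rfl fun i _ => ?_
      rw [Matrix.diag_apply, Matrix.mul_apply, Finset.mul_sum]
      refine Finset.sum_congr rfl fun j _ => ?_
      rw [hc, gMat_comm hg]; ring
    have hn' : (n : ℝ) ≠ 0 := by positivity
    rw [h1, Finset.mul_sum, ← Finset.sum_sub_distrib]
    refine Finset.sum_eq_zero fun k _ => ?_
    rw [Finset.mul_sum, ← Finset.sum_sub_distrib]
    refine Finset.sum_eq_zero fun j _ => ?_
    rw [hc]
    field_simp
    ring

end LocalForms

section SchwarzianForms

variable {n : ℕ} {L Q : Coord n × Coord n → ℝ} {z : Coord n × Coord n} {u : Coord n → ℝ}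

/-- The fundamental tensor does not vary along the fibre, to first order at `z`. -/
def IsVertFlat (Q : Coord n × Coord n → ℝ) (z : Coord n × Coord n) : Prop :=
  ∀ A X Y, metricDeriv Q z (0, A) X Y = 0

/-- `V` is the gradient of `u` at `z`. -/
def IsGradient (Q : Coord n × Coord n → ℝ) (u : Coord n → ℝ) (z : Coord n × Coord n)
    (V : Coord n) : Prop :=
  ∀ Y, metricForm Q z V Y = fderiv ℝ u z.1 Y

lemma metricForm_eq_dotProduct (hQ : ContDiffAt ℝ ∞ (fun w => L w ^ 2) z) (X Y : Coord n) :
    metricForm (fun w => L w ^ 2) z X Y = ∑ i, ∑ j, gMat L z i j * X i * Y j := by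
  rw [metricForm_eq_sum]
  simp only [gMat_eq_metricForm (hQ.of_le two_le_smooth)]

lemma metricForm_comm (hQ : ContDiffAt ℝ ∞ Q z) (X Y : Coord n) :
    metricForm Q z X Y = metricForm Q z Y X := by
  have h : IsSymmSndFDerivAt ℝ Q z := hQ.isSymmSndFDerivAt (by simpa using two_le_smooth)
  simp only [metricForm, h.eq (0, X) (0, Y)]

lemma metricForm_pos (hQ : ContDiffAt ℝ ∞ (fun w => L w ^ 2) z) (hg : (gMat L z).PosDef)
    {X : Coord n} (hX : X ≠ 0) : 0 < metricForm (fun w => L w ^ 2) z X X := by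
  have hX' : (X.ofLp : Fin n → ℝ) ≠ 0 := by
    intro h; apply hX; ext i; exact congrFun h i
  have h := hg.dotProduct_mulVec_pos hX'
  rw [metricForm_eq_dotProduct hQ]
  refine lt_of_lt_of_eq h ?_
  simp only [dotProduct, Matrix.mulVec, Finset.mul_sum, Pi.star_apply, star_trivial]
  exact Finset.sum_congr rfl fun i _ => Finset.sum_congr rfl fun j _ => by ring

lemma IsGradient.sum_gInv (hQ : ContDiffAt ℝ ∞ (fun w => L w ^ 2) z) (hg : (gMat L z).PosDef)
    {V : Coord n} (hV : IsGradient (fun w => L w ^ 2) u z V) (l : Fin n) :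
    ∑ i, gInv L z i l * pd i u z.1 = V l := by
  have h1 : ∀ i, pd i u z.1 = ∑ m, gMat L z i m * V m := by
    intro i
    have := hV (stdVec i)
    rw [metricForm_comm hQ, metricForm_eq_dotProduct hQ] at this
    rw [pd, ← this]
    simp
  have h2 : ∀ m, ∑ i, gInv L z i l * gMat L z i m = if l = m then 1 else 0 := by
    intro m
    have := congrFun (congrFun (gInv_mul_gMat hg) l) m
    rw [Matrix.mul_apply, Matrix.one_apply] at this
    rw [← this]
    exact Finset.sum_congr rfl fun i _ => by rw [gInv_comm hg]
  simp only [h1, Finset.mul_sum]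
  rw [Finset.sum_comm]
  simp only [← mul_assoc, ← Finset.sum_mul, h2]
  simp

lemma exists_isGradient (hQ : ContDiffAt ℝ ∞ (fun w => L w ^ 2) z) (hg : (gMat L z).PosDef)
    (u : Coord n → ℝ) : ∃ V, IsGradient (fun w => L w ^ 2) u z V := by
  let B : Coord n →ₗ[ℝ] Coord n →ₗ[ℝ] ℝ := LinearMap.mk₂ ℝ (metricForm (fun w => L w ^ 2) z)
    metricForm_add_left metricForm_smul_left metricForm_add_right metricForm_smul_right
  let B' : Coord n →L[ℝ] Coord n →L[ℝ] ℝ := LinearMap.toContinuousLinearMap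
    ((LinearMap.toContinuousLinearMap : (Coord n →ₗ[ℝ] ℝ) ≃ₗ[ℝ] (Coord n →L[ℝ] ℝ)).toLinearMap ∘ₗ B)
  obtain ⟨A, hA⟩ := exists_continuousLinearEquiv_dual B' fun X hX => metricForm_pos hQ hg hX
  refine ⟨A.symm (fderiv ℝ u z.1), fun Y => ?_⟩
  change B' _ Y = _
  rw [← hA]
  simp

lemma pd_pd_eq (hu : ContDiffAt ℝ ∞ u z.1) (k j : Fin n) :
    pd k (pd j u) z.1 = fderiv ℝ (fderiv ℝ u) z.1 (stdVec k) (stdVec j) :=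
  fderiv_fderiv_apply (hu.of_le two_le_smooth) _ _

lemma pdy_gMat_eq_zero (hQ : ContDiffAt ℝ ∞ (fun w => L w ^ 2) z)
    (hflat : IsVertFlat (fun w => L w ^ 2) z) (l i j : Fin n) :
    pdy l (fun w => gMat L w i j) z = 0 := by
  rw [pdy, fderiv_gMat hQ]
  exact hflat _ _ _

lemma cartan_eq_zero (hQ : ContDiffAt ℝ ∞ (fun w => L w ^ 2) z)
    (hflat : IsVertFlat (fun w => L w ^ 2) z) (i j k : Fin n) : cartan L i j k z = 0 := by
  simp [cartan, pdy_gMat_eq_zero hQ hflat]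

lemma sum_gam_eq_christoffel (hQ : ContDiffAt ℝ ∞ (fun w => L w ^ 2) z) (hg : (gMat L z).PosDef)
    (hflat : IsVertFlat (fun w => L w ^ 2) z) {V : Coord n}
    (hV : IsGradient (fun w => L w ^ 2) u z V) (j k : Fin n) :
    ∑ i, gam L i j k z * pd i u z.1
      = christoffel (fun w => L w ^ 2) z (stdVec j) (stdVec k) V := by
  have h1 : ∀ a i j, hor L a (fun w => gMat L w i j) z
      = metricDeriv (fun w => L w ^ 2) z (stdVec a, 0) (stdVec i) (stdVec j) := by
    intro a i j
    simp only [hor, pdy_gMat_eq_zero hQ hflat, mul_zero, Finset.sum_const_zero, sub_zero]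
    exact fderiv_gMat hQ _ _ _
  rw [linear_eq_sum (christoffel_add_right _ _) (fun c X => christoffel_smul_right c _ _ X) V]
  simp only [← hV.sum_gInv hQ hg, gam, h1, christoffel, Finset.mul_sum, Finset.sum_mul]
  rw [Finset.sum_comm]
  exact Finset.sum_congr rfl fun i _ => Finset.sum_congr rfl fun l _ => by ring

/-- In the vertically flat case the Schwarzian tensor vanishes iff `Hess u - du ⊗ du` is
proportional to the metric. -/
theorem schwarzianLoc_eq_zero_iff_of_flat (hn : 0 < n)
    (hQ : ContDiffAt ℝ ∞ (fun w => L w ^ 2) z) (hg : (gMat L z).PosDef)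
    (hu : ContDiffAt ℝ ∞ u z.1) (hflat : IsVertFlat (fun w => L w ^ 2) z) {V : Coord n}
    (hV : IsGradient (fun w => L w ^ 2) u z V) :
    (∀ X Y, schwarzianLoc L u z X Y = 0) ↔
      ∃ c : ℝ, ∀ X Y, fderiv ℝ (fderiv ℝ u) z.1 X Y - christoffel (fun w => L w ^ 2) z Y X V
        - fderiv ℝ u z.1 X * fderiv ℝ u z.1 Y = c * metricForm (fun w => L w ^ 2) z X Y := by
  rw [schwarzianLoc_eq_zero_iff hn hg]
  have hco : ∀ k j, schwarzianCoeff L u z k j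
      = fderiv ℝ (fderiv ℝ u) z.1 (stdVec k) (stdVec j)
        - christoffel (fun w => L w ^ 2) z (stdVec j) (stdVec k) V
        - fderiv ℝ u z.1 (stdVec k) * fderiv ℝ u z.1 (stdVec j) := by
    intro k j
    rw [schwarzianCoeff, pd_pd_eq hu, sum_gam_eq_christoffel hQ hg hflat hV]
    rfl
  constructor
  · rintro ⟨-, c, hc⟩
    refine ⟨c, fun X Y => ?_⟩
    have h := bilinear_eq_sum (f := fun X Y => fderiv ℝ (fderiv ℝ u) z.1 X Y
        - christoffel (fun w => L w ^ 2) z Y X V - fderiv ℝ u z.1 X * fderiv ℝ u z.1 Y)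
      (fun X X' Y => by simp only [map_add, add_apply, christoffel_add_mid]; ring)
      (fun c X Y => by
        simp only [map_smul, smul_apply, smul_eq_mul, christoffel_smul_mid]; ring)
      (fun X Y Y' => by simp only [map_add, christoffel_add_left]; ring)
      (fun c X Y => by simp only [map_smul, smul_eq_mul, christoffel_smul_left]; ring) X Y
    simp only at h
    rw [h, metricForm_eq_dotProduct hQ]
    simp only [← hco, hc, Finset.mul_sum, mul_assoc]
  · rintro ⟨c, hc⟩
    refine ⟨fun j k => by simp [cartan_eq_zero hQ hflat], c, fun k j => ?_⟩
    rw [hco, hc, gMat_eq_metricForm (hQ.of_le two_le_smooth)]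

/-- At a critical point of `u` the Schwarzian tensor vanishes iff the second derivative of `u` is
proportional to the metric. -/
theorem schwarzianLoc_eq_zero_iff_of_critical (hn : 0 < n)
    (hQ : ContDiffAt ℝ ∞ (fun w => L w ^ 2) z) (hg : (gMat L z).PosDef)
    (hu : ContDiffAt ℝ ∞ u z.1) (hd : fderiv ℝ u z.1 = 0) :
    (∀ X Y, schwarzianLoc L u z X Y = 0) ↔
      ∃ c : ℝ, ∀ X Y, fderiv ℝ (fderiv ℝ u) z.1 X Y
        = c * metricForm (fun w => L w ^ 2) z X Y := by
  rw [schwarzianLoc_eq_zero_iff hn hg]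
  have hpd : ∀ i, pd i u z.1 = 0 := fun i => by simp [pd, hd]
  have hco : ∀ k j, schwarzianCoeff L u z k j
      = fderiv ℝ (fderiv ℝ u) z.1 (stdVec k) (stdVec j) := by
    intro k j
    simp [schwarzianCoeff, pd_pd_eq hu, hpd]
  constructor
  · rintro ⟨-, c, hc⟩
    refine ⟨c, fun X Y => ?_⟩
    have h := bilinear_eq_sum (f := fun X Y => fderiv ℝ (fderiv ℝ u) z.1 X Y)
      (fun X X' Y => by simp) (fun c X Y => by simp) (fun X Y Y' => by simp)
      (fun c X Y => by simp) X Y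
    simp only at h
    rw [h, metricForm_eq_dotProduct hQ]
    simp only [← hco, hc, Finset.mul_sum, mul_assoc]
  · rintro ⟨c, hc⟩
    refine ⟨fun j k => by simp [hpd], c, fun k j => ?_⟩
    rw [hco, hc, gMat_eq_metricForm (hQ.of_le two_le_smooth)]

/-- If the Schwarzian tensor vanishes, the metric is constant along the fibre in the direction of
the gradient. -/
lemma metricDeriv_gradient_eq_zero (hQ : ContDiffAt ℝ ∞ (fun w => L w ^ 2) z)
    (hg : (gMat L z).PosDef) (h : ∀ X Y, schwarzianLoc L u z X Y = 0) {V : Coord n}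
    (hV : IsGradient (fun w => L w ^ 2) u z V) (X Y : Coord n) :
    metricDeriv (fun w => L w ^ 2) z (0, V) X Y = 0 := by
  rw [bilinear_eq_sum (metricDeriv_add_left _) (metricDeriv_smul_left _)
    (metricDeriv_add_right _) (metricDeriv_smul_right _) X Y]
  refine Finset.sum_eq_zero fun j _ => Finset.sum_eq_zero fun k _ => ?_
  have h1 := cartan_contraction_eq_zero h j k
  have h2 : metricDeriv (fun w => L w ^ 2) z (0, V) (stdVec j) (stdVec k)
      = 2 * ∑ i, cartan L i j k z * pd i u z.1 := by
    rw [linear_eq_sum (f := fun V => metricDeriv (fun w => L w ^ 2) z (0, V) (stdVec j) (stdVec k))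
      (fun X Y => by simp only [inr_add, metricDeriv_add_dir])
      (fun c X => by simp only [inr_smul, metricDeriv_smul_dir]) V]
    simp only [← hV.sum_gInv hQ hg, cartan, pdy, fderiv_gMat hQ, Finset.mul_sum, Finset.sum_mul]
    rw [Finset.sum_comm]
    exact Finset.sum_congr rfl fun i _ => Finset.sum_congr rfl fun l _ => by ring
  rw [h2, h1]; simp

/-- Let `L` be a Finsler function on the fibre over `x`. If the Schwarzian tensor of `u` vanishes
on this fibre and `du ≠ 0` at `x`, then `L` is Riemannian on the fibre. -/
theorem isVertFlat_of_schwarzianLoc_eq_zero {x : Coord n}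
    (hQ : ∀ y : Coord n, y ≠ 0 → ContDiffAt ℝ ∞ (fun w => L w ^ 2) (x, y))
    (hom : ∀ (y : Coord n) (c : ℝ), 0 < c → L (x, c • y) = c * L (x, y))
    (hg : ∀ y : Coord n, y ≠ 0 → (gMat L (x, y)).PosDef)
    (h : ∀ y : Coord n, y ≠ 0 → ∀ X Y, schwarzianLoc L u (x, y) X Y = 0)
    (hd : fderiv ℝ u x ≠ 0) {y : Coord n} (hy : y ≠ 0) :
    IsVertFlat (fun w => L w ^ 2) (x, y) := by
  set Q : Coord n × Coord n → ℝ := fun w => L w ^ 2 with hQdef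
  set e : Coord n → ℝ := fun y => Q (x, y) with he
  let I := ContinuousLinearMap.inr ℝ (Coord n) (Coord n)
  have hI : ∀ y : Coord n, HasFDerivAt (fun y : Coord n => (x, y)) I y := fun y =>
    hasFDerivAt_prodMk_right x y
  have hsm : ∀ y : Coord n, y ≠ 0 → ContDiffAt ℝ ∞ e y := fun y hy =>
    (hQ y hy).comp y (contDiff_prodMk_right x).contDiffAt
  have h1 : ∀ y : Coord n, y ≠ 0 → ∀ X, fderiv ℝ e y X = fderiv ℝ Q (x, y) (0, X) := by
    intro y hy X
    have := (((hQ y hy).differentiableAt (by simp)).hasFDerivAt).comp y (hI y)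
    exact congrArg (fun t => t X) this.fderiv
  have hne : ∀ y : Coord n, y ≠ 0 → ∀ᶠ w in nhds y, w ≠ 0 := fun y hy => isOpen_ne.mem_nhds hy
  have h2 : ∀ y : Coord n, y ≠ 0 → ∀ X Y, fderiv ℝ (fderiv ℝ e) y X Y
      = 2 * metricForm Q (x, y) X Y := by
    intro y hy X Y
    rw [← fderiv_fderiv_apply ((hsm y hy).of_le two_le_smooth)]
    have ha : (fun w => fderiv ℝ e w Y) =ᶠ[nhds y] fun w => fderiv ℝ Q (x, w) (0, Y) := by
      filter_upwards [hne y hy] with w hw using h1 w hw Y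
    have hb := (hasFDerivAt_fderiv_apply ((hQ y hy).of_le two_le_smooth)
      ((0 : Coord n), Y)).comp y (hI y)
    rw [ha.fderiv_eq]
    have hc := congrArg (fun t => t X) hb.fderiv
    refine Eq.trans hc ?_
    simp [metricForm, I]
  have h3 : ∀ y : Coord n, y ≠ 0 → ∀ A X Y, fderiv ℝ (fderiv ℝ (fderiv ℝ e)) y A X Y
      = 2 * metricDeriv Q (x, y) (0, A) X Y := by
    intro y hy A X Y
    have h3' : (3 : WithTop ℕ∞) ≤ ∞ := WithTop.coe_le_coe.2 (le_top : (3 : ℕ∞) ≤ ⊤)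
    have ha : (fun w => fderiv ℝ (fderiv ℝ e) w X Y)
        =ᶠ[nhds y] fun w => fderiv ℝ (fderiv ℝ Q) (x, w) (0, X) (0, Y) := by
      filter_upwards [hne y hy] with w hw
      rw [h2 w hw, metricForm]; ring
    have hb := (hasFDerivAt_hessian_apply ((hQ y hy).of_le h3')
      ((0 : Coord n), X) ((0 : Coord n), Y)).comp y (hI y)
    have hc := (hasFDerivAt_hessian_apply ((hsm y hy).of_le h3') X Y).fderiv
    have hd := congrArg (fun t => t A) (hc.symm.trans (ha.fderiv_eq.trans hb.fderiv))
    refine Eq.trans hd ?_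
    simp [metricDeriv, I]
  have hflat : ∀ y : Coord n, y ≠ 0 → fderiv ℝ (fderiv ℝ (fderiv ℝ e)) y = 0 := by
    intro y hy
    refine fderiv_hessian_eq_zero hsm ?_ ?_ hd ?_ hy
    · intro y c hc
      simp only [he, hQdef, hom y c hc]; ring
    · intro y hy X hX
      rw [h2 y hy]
      have := metricForm_pos (hQ y hy) (hg y hy) hX
      positivity
    · intro y hy V hV
      ext X Y
      rw [h3 y hy]
      have hgr : IsGradient Q u (x, y) ((2 : ℝ) • V) := by
        intro Y
        rw [metricForm_smul_left, ← h2 y hy, hV]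
      have := metricDeriv_gradient_eq_zero (hQ y hy) (hg y hy) (h y hy) hgr X Y
      rw [inr_smul, metricDeriv_smul_dir] at this
      simpa using this
  intro A X Y
  have := h3 y hy A X Y
  rw [hflat y hy] at this
  simp at this
  exact this

end SchwarzianForms

section Pullback

variable {n : ℕ}

/-- The map `(x, y) ↦ (T x, DT_x y)`. -/
def tangentLift (T : Coord n → Coord n) (w : Coord n × Coord n) : Coord n × Coord n :=
  (T w.1, fderiv ℝ T w.1 w.2)

/-- `Q' = ρ · Q ∘ tangentLift T` near `w`, with smooth data. -/
structure IsPullbackAt (Q' Q : Coord n × Coord n → ℝ) (ρ : Coord n → ℝ) (T : Coord n → Coord n)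
    (w : Coord n × Coord n) : Prop where
  smooth_map : ContDiffAt ℝ 4 T w.1
  smooth_target : ContDiffAt ℝ 4 Q (tangentLift T w)
  smooth_factor : ContDiffAt ℝ 4 ρ w.1
  eventuallyEq : Q' =ᶠ[nhds w] fun w => ρ w.1 * Q (tangentLift T w)

variable {Q' Q : Coord n × Coord n → ℝ} {ρ : Coord n → ℝ} {T : Coord n → Coord n}
  {w : Coord n × Coord n}

lemma hasFDerivAt_fderiv (hT : ContDiffAt ℝ 4 T w.1) :
    HasFDerivAt (fderiv ℝ T) (fderiv ℝ (fderiv ℝ T) w.1) w.1 :=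
  ((hT.fderiv_right (m := 3) (by norm_num)).differentiableAt (by simp)).hasFDerivAt

/-- The derivative of `tangentLift T`. -/
def tangentLiftDeriv (T : Coord n → Coord n) (w : Coord n × Coord n) :
    Coord n × Coord n →L[ℝ] Coord n × Coord n :=
  ((fderiv ℝ T w.1).comp (ContinuousLinearMap.fst ℝ (Coord n) (Coord n))).prod
    (((fderiv ℝ T w.1).comp (ContinuousLinearMap.snd ℝ (Coord n) (Coord n))) +
      ((fderiv ℝ (fderiv ℝ T) w.1).comp (ContinuousLinearMap.fst ℝ (Coord n) (Coord n))).flip w.2)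

lemma tangentLiftDeriv_apply (A : Coord n × Coord n) :
    tangentLiftDeriv T w A
      = (fderiv ℝ T w.1 A.1, fderiv ℝ T w.1 A.2 + fderiv ℝ (fderiv ℝ T) w.1 A.1 w.2) := rfl

lemma hasFDerivAt_tangentLift (hT : ContDiffAt ℝ 4 T w.1) :
    HasFDerivAt (tangentLift T) (tangentLiftDeriv T w) w := by
  have h1 : HasFDerivAt (fun w : Coord n × Coord n => T w.1)
      ((fderiv ℝ T w.1).comp (ContinuousLinearMap.fst ℝ _ _)) w :=
    (hT.differentiableAt (by simp)).hasFDerivAt.comp w hasFDerivAt_fst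
  have h2 : HasFDerivAt (fun w : Coord n × Coord n => fderiv ℝ T w.1)
      ((fderiv ℝ (fderiv ℝ T) w.1).comp (ContinuousLinearMap.fst ℝ _ _)) w :=
    (hasFDerivAt_fderiv hT).comp w hasFDerivAt_fst
  exact h1.prodMk (h2.clm_apply hasFDerivAt_snd)

lemma hasFDerivAt_inr_fderiv (hT : ContDiffAt ℝ 4 T w.1) (Y : Coord n) :
    HasFDerivAt (fun w : Coord n × Coord n => ((0 : Coord n), fderiv ℝ T w.1 Y))
      ((ContinuousLinearMap.inr ℝ (Coord n) (Coord n)).comp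
        (((fderiv ℝ (fderiv ℝ T) w.1).comp (ContinuousLinearMap.fst ℝ _ _)).flip Y)) w := by
  have h2 : HasFDerivAt (fun w : Coord n × Coord n => fderiv ℝ T w.1)
      ((fderiv ℝ (fderiv ℝ T) w.1).comp (ContinuousLinearMap.fst ℝ _ _)) w :=
    (hasFDerivAt_fderiv hT).comp w hasFDerivAt_fst
  have h3 := h2.clm_apply (hasFDerivAt_const Y w)
  have h4 := (ContinuousLinearMap.inr ℝ (Coord n) (Coord n)).hasFDerivAt.comp w h3
  refine h4.congr_fderiv ?_
  simp

lemma exists_hasFDerivAt_clm_apply₂ {E F : Type*} [NormedAddCommGroup E] [NormedSpace ℝ E]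
    [NormedAddCommGroup F] [NormedSpace ℝ F] {c : E → F →L[ℝ] F →L[ℝ] ℝ}
    {c' : E →L[ℝ] F →L[ℝ] F →L[ℝ] ℝ} {a b : E → F} {a' b' : E →L[ℝ] F} {x : E}
    (hc : HasFDerivAt c c' x) (ha : HasFDerivAt a a' x) (hb : HasFDerivAt b b' x) :
    ∃ D : E →L[ℝ] ℝ, HasFDerivAt (fun w => c w (a w) (b w)) D x ∧
      ∀ A, D A = c' A (a x) (b x) + c x (a' A) (b x) + c x (a x) (b' A) := by
  refine ⟨_, (hc.clm_apply ha).clm_apply hb, fun A => ?_⟩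
  simp only [add_apply, ContinuousLinearMap.comp_apply, ContinuousLinearMap.flip_apply]
  ring

namespace IsPullbackAt

lemma eventually (h : IsPullbackAt Q' Q ρ T w) : ∀ᶠ v in nhds w, IsPullbackAt Q' Q ρ T v := by
  have h1 := (h.smooth_map.eventually (by decide)).filter_mono
    (continuous_fst.tendsto w)
  have h2 := (h.smooth_target.eventually (by decide)).filter_mono
    (hasFDerivAt_tangentLift h.smooth_map).continuousAt
  have h3 := (h.smooth_factor.eventually (by decide)).filter_mono
    (continuous_fst.tendsto w)
  filter_upwards [h1, h2, h3, h.eventuallyEq.eventually_nhds] with v a b c d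
  exact ⟨a, b, c, d⟩

lemma hasFDerivAt_factor (h : IsPullbackAt Q' Q ρ T w) :
    HasFDerivAt (fun w : Coord n × Coord n => ρ w.1)
      ((fderiv ℝ ρ w.1).comp (ContinuousLinearMap.fst ℝ _ _)) w :=
  (h.smooth_factor.differentiableAt (by simp)).hasFDerivAt.comp w hasFDerivAt_fst

lemma fderiv_vert (h : IsPullbackAt Q' Q ρ T w) (Y : Coord n) :
    fderiv ℝ Q' w (0, Y) = ρ w.1 * fderiv ℝ Q (tangentLift T w) (0, fderiv ℝ T w.1 Y) := by
  have h1 := (h.smooth_target.differentiableAt (by simp)).hasFDerivAt.comp w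
    (hasFDerivAt_tangentLift h.smooth_map)
  have h2 := h.hasFDerivAt_factor.mul h1
  rw [(h2.congr_of_eventuallyEq h.eventuallyEq).fderiv]
  simp [tangentLiftDeriv_apply]

lemma metricForm_eq (h : IsPullbackAt Q' Q ρ T w) (hQ' : ContDiffAt ℝ 4 Q' w) (X Y : Coord n) :
    metricForm Q' w X Y
      = ρ w.1 * metricForm Q (tangentLift T w) (fderiv ℝ T w.1 X) (fderiv ℝ T w.1 Y) := by
  have hH : HasFDerivAt (fderiv ℝ Q) (fderiv ℝ (fderiv ℝ Q) (tangentLift T w))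
      (tangentLift T w) :=
    ((h.smooth_target.fderiv_right (m := 3) (by norm_num)).differentiableAt (by simp)).hasFDerivAt
  have h1 := h.hasFDerivAt_factor.mul
    ((hH.comp w (hasFDerivAt_tangentLift h.smooth_map)).clm_apply
      (hasFDerivAt_inr_fderiv h.smooth_map Y))
  have h2 : (fun w => fderiv ℝ Q' w (0, Y)) =ᶠ[nhds w]
      fun w => ρ w.1 * fderiv ℝ Q (tangentLift T w) (0, fderiv ℝ T w.1 Y) := by
    filter_upwards [h.eventually] with v hv using hv.fderiv_vert Y
  rw [metricForm, ← fderiv_fderiv_apply (hQ'.of_le (by norm_num)),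
    (h1.congr_of_eventuallyEq h2).fderiv]
  have h0 : ((0 : Coord n), (0 : Coord n)) = 0 := rfl
  simp [tangentLiftDeriv_apply, metricForm]
  rw [h0, map_zero]
  ring

lemma metricDeriv_eq (h : IsPullbackAt Q' Q ρ T w) (hQ' : ContDiffAt ℝ 4 Q' w)
    (A : Coord n × Coord n) (X Y : Coord n) :
    metricDeriv Q' w A X Y
      = fderiv ℝ ρ w.1 A.1
          * metricForm Q (tangentLift T w) (fderiv ℝ T w.1 X) (fderiv ℝ T w.1 Y)
        + ρ w.1 * (metricDeriv Q (tangentLift T w) (tangentLiftDeriv T w A)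
            (fderiv ℝ T w.1 X) (fderiv ℝ T w.1 Y)
          + metricForm Q (tangentLift T w) (fderiv ℝ (fderiv ℝ T) w.1 A.1 X) (fderiv ℝ T w.1 Y)
          + metricForm Q (tangentLift T w) (fderiv ℝ T w.1 X)
              (fderiv ℝ (fderiv ℝ T) w.1 A.1 Y)) := by
  have hH : HasFDerivAt (fderiv ℝ (fderiv ℝ Q))
      (fderiv ℝ (fderiv ℝ (fderiv ℝ Q)) (tangentLift T w)) (tangentLift T w) :=
    (((h.smooth_target.fderiv_right (m := 3) (by norm_num)).fderiv_right (m := 2)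
      (by norm_num)).differentiableAt (by simp)).hasFDerivAt
  obtain ⟨D, hD, hDA⟩ := exists_hasFDerivAt_clm_apply₂
    (HasFDerivAt.comp (g := fderiv ℝ (fderiv ℝ Q))
      (g' := fderiv ℝ (fderiv ℝ (fderiv ℝ Q)) (tangentLift T w)) w hH
      (hasFDerivAt_tangentLift h.smooth_map))
    (hasFDerivAt_inr_fderiv h.smooth_map X) (hasFDerivAt_inr_fderiv h.smooth_map Y)
  have h1 := h.hasFDerivAt_factor.mul (hD.const_mul (1 / 2))
  have h2 : (fun w => metricForm Q' w X Y) =ᶠ[nhds w]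
      fun w => ρ w.1 * metricForm Q (tangentLift T w) (fderiv ℝ T w.1 X) (fderiv ℝ T w.1 Y) := by
    filter_upwards [h.eventually, hQ'.eventually (by decide)] with v hv hv'
      using hv.metricForm_eq hv' X Y
  rw [← fderiv_metricForm (hQ'.of_le (by norm_num)), (h1.congr_of_eventuallyEq h2).fderiv]
  simp only [add_apply, smul_apply, smul_eq_mul, hDA, metricForm, metricDeriv,
    ContinuousLinearMap.comp_apply, ContinuousLinearMap.flip_apply, Function.comp_apply,
    ContinuousLinearMap.inr_apply, ContinuousLinearMap.coe_fst']
  ring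

end IsPullbackAt

end Pullback

section SchwarzianPullback

variable {n : ℕ} {L' L Q' Q : Coord n × Coord n → ℝ} {ρ u ψ : Coord n → ℝ}
  {T : Coord n → Coord n} {w : Coord n × Coord n}

lemma IsVertFlat.metricDeriv_eq {z : Coord n × Coord n} (h : IsVertFlat Q z)
    (A : Coord n × Coord n) (X Y : Coord n) :
    metricDeriv Q z A X Y = metricDeriv Q z (A.1, 0) X Y := by
  have hA : A = (A.1, 0) + (0, A.2) := by simp
  rw [hA, metricDeriv_add_dir, h, add_zero]
  simp

lemma IsPullbackAt.isVertFlat_iff (h : IsPullbackAt Q' Q ρ T w) (hQ' : ContDiffAt ℝ 4 Q' w)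
    (hρ : ρ w.1 ≠ 0) (hT : Function.Surjective (fderiv ℝ T w.1)) :
    IsVertFlat Q' w ↔ IsVertFlat Q (tangentLift T w) := by
  have h1 : ∀ A X Y, metricDeriv Q' w (0, A) X Y = ρ w.1 * metricDeriv Q (tangentLift T w)
      (0, fderiv ℝ T w.1 A) (fderiv ℝ T w.1 X) (fderiv ℝ T w.1 Y) := by
    intro A X Y
    have h0 : ∀ Z, metricForm Q (tangentLift T w) 0 Z = 0 := fun Z => by
      simpa using metricForm_smul_left (Q := Q) (z := tangentLift T w) 0 0 Z
    have h0' : ∀ Z, metricForm Q (tangentLift T w) Z 0 = 0 := fun Z => by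
      simpa using metricForm_smul_right (Q := Q) (z := tangentLift T w) 0 Z 0
    rw [h.metricDeriv_eq hQ', tangentLiftDeriv_apply]
    simp only [map_zero, zero_mul, zero_add, zero_apply, add_zero, h0, h0']
  constructor
  · intro hf A X Y
    obtain ⟨A, rfl⟩ := hT A
    obtain ⟨X, rfl⟩ := hT X
    obtain ⟨Y, rfl⟩ := hT Y
    have := h1 A X Y
    rw [hf] at this
    exact (mul_eq_zero.1 this.symm).resolve_left hρ
  · intro hf A X Y
    rw [h1, hf, mul_zero]

/-- The Christoffel symbols of a conformally rescaled pullback metric. -/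
lemma IsPullbackAt.christoffel_eq (h : IsPullbackAt Q' Q ρ T w) (hQ' : ContDiffAt ℝ 4 Q' w)
    (hQ : ContDiffAt ℝ ∞ Q (tangentLift T w))
    (hflat : IsVertFlat Q (tangentLift T w)) {p : Coord n →L[ℝ] ℝ}
    (hp : fderiv ℝ ρ w.1 = (-2 * ρ w.1) • p) (X Y Z : Coord n) :
    christoffel Q' w X Y Z = ρ w.1 *
      (christoffel Q (tangentLift T w) (fderiv ℝ T w.1 X) (fderiv ℝ T w.1 Y) (fderiv ℝ T w.1 Z)
        + metricForm Q (tangentLift T w) (fderiv ℝ T w.1 Z) (fderiv ℝ (fderiv ℝ T) w.1 X Y)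
        - p X * metricForm Q (tangentLift T w) (fderiv ℝ T w.1 Z) (fderiv ℝ T w.1 Y)
        - p Y * metricForm Q (tangentLift T w) (fderiv ℝ T w.1 Z) (fderiv ℝ T w.1 X)
        + p Z * metricForm Q (tangentLift T w) (fderiv ℝ T w.1 X) (fderiv ℝ T w.1 Y)) := by
  have hs : IsSymmSndFDerivAt ℝ T w.1 := h.smooth_map.isSymmSndFDerivAt
    (by rw [minSmoothness_of_isRCLikeNormedField]; norm_num)
  have hc := metricForm_comm hQ
  simp only [christoffel, h.metricDeriv_eq hQ', hp, smul_apply, smul_eq_mul]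
  rw [hflat.metricDeriv_eq (tangentLiftDeriv T w (X, 0)),
    hflat.metricDeriv_eq (tangentLiftDeriv T w (Y, 0)),
    hflat.metricDeriv_eq (tangentLiftDeriv T w (Z, 0))]
  simp only [tangentLiftDeriv_apply]
  rw [hs.eq Y X, hs.eq Z X, hs.eq Z Y,
    hc (fderiv ℝ (fderiv ℝ T) w.1 X Z), hc (fderiv ℝ (fderiv ℝ T) w.1 X Y),
    hc (fderiv ℝ T w.1 X) (fderiv ℝ T w.1 Z),
    hc (fderiv ℝ T w.1 X) (fderiv ℝ (fderiv ℝ T) w.1 Y Z)]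
  ring

lemma fderiv_comp_add {x : Coord n} (hT : ContDiffAt ℝ ∞ T x) (hu : ContDiffAt ℝ ∞ u (T x))
    (hψ : ContDiffAt ℝ ∞ ψ x) (X : Coord n) :
    fderiv ℝ (fun x => u (T x) + ψ x) x X
      = fderiv ℝ u (T x) (fderiv ℝ T x X) + fderiv ℝ ψ x X := by
  have h1 := (hu.differentiableAt (by simp)).hasFDerivAt.comp x
    (hT.differentiableAt (by simp)).hasFDerivAt
  have h2 := h1.add (hψ.differentiableAt (by simp)).hasFDerivAt
  exact congrArg (fun t => t X) h2.fderiv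

lemma fderiv_fderiv_comp_add {x : Coord n} (hT : ContDiffAt ℝ ∞ T x)
    (hu : ContDiffAt ℝ ∞ u (T x)) (hψ : ContDiffAt ℝ ∞ ψ x) (X Y : Coord n) :
    fderiv ℝ (fderiv ℝ (fun x => u (T x) + ψ x)) x X Y
      = fderiv ℝ (fderiv ℝ u) (T x) (fderiv ℝ T x X) (fderiv ℝ T x Y)
        + fderiv ℝ u (T x) (fderiv ℝ (fderiv ℝ T) x X Y) + fderiv ℝ (fderiv ℝ ψ) x X Y := by
  have hT2 := hT.of_le two_le_smooth
  have hu2 := hu.of_le two_le_smooth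
  have hψ2 := hψ.of_le two_le_smooth
  have hχ : ContDiffAt ℝ 2 (fun x => u (T x) + ψ x) x := (hu2.comp x hT2).add hψ2
  rw [← fderiv_fderiv_apply hχ]
  have he : (fun v => fderiv ℝ (fun x => u (T x) + ψ x) v Y) =ᶠ[nhds x]
      fun v => fderiv ℝ u (T v) (fderiv ℝ T v Y) + fderiv ℝ ψ v Y := by
    filter_upwards [hT2.eventually (by simp), hψ2.eventually (by simp),
      (hu2.eventually (by simp)).filter_mono hT2.continuousAt] with v h1 h2 h3
    have h3' : ContDiffAt ℝ 2 u (T v) := h3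
    have h4 := (h3'.differentiableAt (by simp)).hasFDerivAt.comp v
      (h1.differentiableAt (by simp)).hasFDerivAt
    have h5 := h4.add (h2.differentiableAt (by simp)).hasFDerivAt
    exact congrArg (fun t => t Y) h5.fderiv
  have hTd : HasFDerivAt T (fderiv ℝ T x) x := (hT.differentiableAt (by simp)).hasFDerivAt
  have hTd2 : HasFDerivAt (fderiv ℝ T) (fderiv ℝ (fderiv ℝ T) x) x :=
    ((hT2.fderiv_right (m := 1) (by norm_num)).differentiableAt (by simp)).hasFDerivAt
  have hud : HasFDerivAt (fderiv ℝ u) (fderiv ℝ (fderiv ℝ u) (T x)) (T x) :=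
    ((hu2.fderiv_right (m := 1) (by norm_num)).differentiableAt (by simp)).hasFDerivAt
  have h1 := (HasFDerivAt.comp (g := fderiv ℝ u) x hud hTd).clm_apply
    (hTd2.clm_apply (hasFDerivAt_const Y x))
  have h2 := h1.add (hasFDerivAt_fderiv_apply hψ2 Y)
  rw [he.fderiv_eq]
  refine Eq.trans (congrArg (fun t => t X) h2.fderiv) ?_
  simp only [add_apply, ContinuousLinearMap.comp_apply, ContinuousLinearMap.flip_apply,
    Function.comp_apply, zero_apply, map_zero, zero_add]
  ring

/-- Let `L' = e^{-ψ} L ∘ (T, DT)` and let the Schwarzian tensor of `u` with respect to `L` vanish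
at the image point. Then the Schwarzian tensors of `ψ` and `u ∘ T + ψ` with respect to `L'` vanish
simultaneously, if the metric is vertically flat or both `u` and `ψ` are critical. -/
theorem schwarzianLoc_pullback (hn : 0 < n)
    (hL : ContDiffAt ℝ ∞ (fun v => L v ^ 2) (tangentLift T w))
    (hL' : ContDiffAt ℝ ∞ (fun v => L' v ^ 2) w)
    (hg : (gMat L (tangentLift T w)).PosDef) (hg' : (gMat L' w).PosDef)
    (hT : ContDiffAt ℝ ∞ T w.1) (hTs : Function.Surjective (fderiv ℝ T w.1))
    (hψ : ContDiffAt ℝ ∞ ψ w.1) (hu : ContDiffAt ℝ ∞ u (T w.1))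
    (heq : L' =ᶠ[nhds w] fun v => Real.exp (-ψ v.1) * L (tangentLift T v))
    (hcase : (IsVertFlat (fun v => L' v ^ 2) w ∨ IsVertFlat (fun v => L v ^ 2) (tangentLift T w)) ∨
      (fderiv ℝ u (T w.1) = 0 ∧ fderiv ℝ ψ w.1 = 0))
    (hB : ∀ X Y, schwarzianLoc L u (tangentLift T w) X Y = 0) :
    (∀ X Y, schwarzianLoc L' ψ w X Y = 0) ↔
      ∀ X Y, schwarzianLoc L' (fun x => u (T x) + ψ x) w X Y = 0 := by
  set Q : Coord n × Coord n → ℝ := fun v => L v ^ 2 with hQ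
  set Q' : Coord n × Coord n → ℝ := fun v => L' v ^ 2 with hQ'
  set ρ : Coord n → ℝ := fun x => Real.exp (-2 * ψ x) with hρ
  have four : (4 : WithTop ℕ∞) ≤ ∞ := WithTop.coe_le_coe.2 (le_top : (4 : ℕ∞) ≤ ⊤)
  have hρ0 : ρ w.1 ≠ 0 := (Real.exp_pos _).ne'
  have hL4' : ContDiffAt ℝ 4 Q' w := hL'.of_le four
  have hP : IsPullbackAt Q' Q ρ T w := by
    refine ⟨hT.of_le four, hL.of_le four,
      Real.contDiff_exp.contDiffAt.comp w.1 (contDiffAt_const.mul (hψ.of_le four)), ?_⟩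
    filter_upwards [heq] with v hv
    simp only [hQ', hQ, hρ, hv, mul_pow, ← Real.exp_nat_mul]
    congr 2
    push_cast; ring
  have hdρ : fderiv ℝ ρ w.1 = (-2 * ρ w.1) • fderiv ℝ ψ w.1 := by
    have h1 := ((hψ.differentiableAt (by simp)).hasFDerivAt.const_mul (-2)).exp
    rw [h1.fderiv, smul_smul, mul_comm]
  have hχ : ContDiffAt ℝ ∞ (fun x => u (T x) + ψ x) w.1 := (hu.comp w.1 hT).add hψ
  have hm := hP.metricForm_eq hL4'
  have hd1 := fderiv_comp_add hT hu hψ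
  have hd2 := fderiv_fderiv_comp_add hT hu hψ
  rcases hcase with hflat | ⟨hcu, hcψ⟩
  · have hf : IsVertFlat Q (tangentLift T w) :=
      hflat.elim (hP.isVertFlat_iff hL4' hρ0 hTs).1 id
    have hf' : IsVertFlat Q' w := (hP.isVertFlat_iff hL4' hρ0 hTs).2 hf
    obtain ⟨V, hV⟩ := exists_isGradient hL hg u
    obtain ⟨V₁, hV₁⟩ := exists_isGradient hL' hg' ψ
    obtain ⟨W, hW⟩ := exists_isGradient hL' hg' (fun x => u (T x))
    have hdu : ∀ X, fderiv ℝ (fun x => u (T x)) w.1 X = fderiv ℝ u (T w.1) (fderiv ℝ T w.1 X) := by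
      intro X
      have h1 := (hu.differentiableAt (by simp)).hasFDerivAt.comp w.1
        (hT.differentiableAt (by simp)).hasFDerivAt
      exact congrArg (fun t => t X) h1.fderiv
    have hTW : ρ w.1 • fderiv ℝ T w.1 W = V := by
      by_contra hne
      have hne' : ρ w.1 • fderiv ℝ T w.1 W + (-1 : ℝ) • V ≠ 0 := by
        simpa [← sub_eq_add_neg, sub_eq_zero] using hne
      have hpos := metricForm_pos hL hg hne'
      have hz : ∀ Z, metricForm Q (tangentLift T w)
          (ρ w.1 • fderiv ℝ T w.1 W + (-1 : ℝ) • V) Z = 0 := by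
        intro Z
        obtain ⟨Z, rfl⟩ := hTs Z
        rw [metricForm_add_left, metricForm_smul_left, metricForm_smul_left, hV, ← hm, hW, hdu]
        simp [tangentLift]
      exact absurd (hz _) hpos.ne'
    have hgrad : IsGradient Q' (fun x => u (T x) + ψ x) w (W + V₁) := by
      intro Y
      rw [metricForm_add_left, hW, hV₁, hd1, hdu]
    rw [schwarzianLoc_eq_zero_iff_of_flat hn hL hg hu hf hV] at hB
    obtain ⟨c, hc⟩ := hB
    rw [schwarzianLoc_eq_zero_iff_of_flat hn hL' hg' hψ hf' hV₁,
      schwarzianLoc_eq_zero_iff_of_flat hn hL' hg' hχ hf' hgrad]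
    have hK : ∀ X Y, christoffel Q' w Y X W
        = christoffel Q (tangentLift T w) (fderiv ℝ T w.1 Y) (fderiv ℝ T w.1 X) V
          + fderiv ℝ u (T w.1) (fderiv ℝ (fderiv ℝ T) w.1 X Y)
          - fderiv ℝ ψ w.1 Y * fderiv ℝ u (T w.1) (fderiv ℝ T w.1 X)
          - fderiv ℝ ψ w.1 X * fderiv ℝ u (T w.1) (fderiv ℝ T w.1 Y)
          + fderiv ℝ ψ w.1 W * metricForm Q' w X Y := by
      intro X Y
      have hs : IsSymmSndFDerivAt ℝ T w.1 :=
        hT.isSymmSndFDerivAt (by simpa using two_le_smooth)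
      have hVY : ∀ Z, ρ w.1 * metricForm Q (tangentLift T w) (fderiv ℝ T w.1 W) Z
          = fderiv ℝ u (T w.1) Z := by
        intro Z
        rw [← metricForm_smul_left, hTW, hV]
        rfl
      rw [hP.christoffel_eq hL4' hL hf hdρ, hm X Y, ← hTW, christoffel_smul_right, ← hVY,
        ← hVY, ← hVY, hs.eq X Y, metricForm_comm hL (fderiv ℝ T w.1 X) (fderiv ℝ T w.1 Y)]
      ring
    have key : ∀ X Y, fderiv ℝ (fderiv ℝ (fun x => u (T x) + ψ x)) w.1 X Y
          - christoffel Q' w Y X (W + V₁)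
          - fderiv ℝ (fun x => u (T x) + ψ x) w.1 X * fderiv ℝ (fun x => u (T x) + ψ x) w.1 Y
        = (fderiv ℝ (fderiv ℝ ψ) w.1 X Y - christoffel Q' w Y X V₁
          - fderiv ℝ ψ w.1 X * fderiv ℝ ψ w.1 Y)
          + (c / ρ w.1 - fderiv ℝ ψ w.1 W) * metricForm Q' w X Y := by
      intro X Y
      have h1 := hc (fderiv ℝ T w.1 X) (fderiv ℝ T w.1 Y)
      simp only [show (tangentLift T w).1 = T w.1 from rfl] at h1
      have h2 : c / ρ w.1 * metricForm Q' w X Y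
          = c * metricForm Q (tangentLift T w) (fderiv ℝ T w.1 X) (fderiv ℝ T w.1 Y) := by
        rw [hm]; field_simp
      rw [sub_mul, h2, ← h1, hd1, hd1, hd2, christoffel_add_right, hK]
      ring
    constructor
    · rintro ⟨d, hd⟩
      refine ⟨d + (c / ρ w.1 - fderiv ℝ ψ w.1 W), fun X Y => ?_⟩
      rw [key, hd]; ring
    · rintro ⟨d, hd⟩
      refine ⟨d - (c / ρ w.1 - fderiv ℝ ψ w.1 W), fun X Y => ?_⟩
      have := hd X Y
      rw [key] at this
      linarith
  · have hcχ : fderiv ℝ (fun x => u (T x) + ψ x) w.1 = 0 := by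
      ext X
      rw [hd1, hcu, hcψ]; simp
    rw [schwarzianLoc_eq_zero_iff_of_critical hn hL hg hu hcu] at hB
    obtain ⟨c, hc⟩ := hB
    rw [schwarzianLoc_eq_zero_iff_of_critical hn hL' hg' hψ hcψ,
      schwarzianLoc_eq_zero_iff_of_critical hn hL' hg' hχ hcχ]
    have key : ∀ X Y, fderiv ℝ (fderiv ℝ (fun x => u (T x) + ψ x)) w.1 X Y
        = fderiv ℝ (fderiv ℝ ψ) w.1 X Y + c / ρ w.1 * metricForm Q' w X Y := by
      intro X Y
      have h1 := hc (fderiv ℝ T w.1 X) (fderiv ℝ T w.1 Y)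
      simp only [show (tangentLift T w).1 = T w.1 from rfl] at h1
      have h2 : c / ρ w.1 * metricForm Q' w X Y
          = c * metricForm Q (tangentLift T w) (fderiv ℝ T w.1 X) (fderiv ℝ T w.1 Y) := by
        rw [hm]; field_simp
      rw [h2, hd2, hcu, h1]
      simp; ring
    constructor
    · rintro ⟨d, hd⟩
      exact ⟨d + c / ρ w.1, fun X Y => by rw [key, hd]; ring⟩
    · rintro ⟨d, hd⟩
      refine ⟨d - c / ρ w.1, fun X Y => ?_⟩
      have := hd X Y
      rw [key] at this
      linarith

lemma pd_congr {u v : Coord n → ℝ} {x : Coord n} (h : u =ᶠ[nhds x] v) (i : Fin n) :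
    pd i u =ᶠ[nhds x] pd i v := by
  filter_upwards [h.eventually_nhds] with y hy
  simp only [pd, Filter.EventuallyEq.fderiv_eq hy]

lemma schwarzianLoc_congr {u v : Coord n → ℝ} {z : Coord n × Coord n} (h : u =ᶠ[nhds z.1] v)
    (X : Coord n × Coord n) (Y : Coord n) : schwarzianLoc L u z X Y = schwarzianLoc L v z X Y := by
  have h1 : ∀ i, pd i u z.1 = pd i v z.1 := fun i => (pd_congr h i).eq_of_nhds
  have h2 : ∀ k j, pd k (pd j u) z.1 = pd k (pd j v) z.1 := fun k j =>
    (pd_congr (pd_congr h j) k).eq_of_nhds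
  simp only [schwarzianLoc, hess, lapH, lapV, gradSq, h1, h2]

lemma schwarzianLoc_const (c : ℝ) (z X : Coord n × Coord n) (Y : Coord n) :
    schwarzianLoc L (fun _ => c) z X Y = 0 := by
  have h1 : ∀ i, pd i (fun _ : Coord n => c) = fun _ => 0 := fun i => by
    funext x; simp [pd]
  have h2 : ∀ i, pd i (fun _ : Coord n => (0 : ℝ)) = fun _ => 0 := fun i => by
    funext x; simp [pd]
  simp [schwarzianLoc, hess, lapH, lapV, gradSq, h1, h2]

end SchwarzianPullback

section BaseCharts

variable {n : ℕ} {M : Type*} [TopologicalSpace M] [ChartedSpace (EuclideanSpace ℝ (Fin n)) M]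

/-- The representation of `f` in the preferred charts at `x` and `f x`. -/
def mapInChart (f : M → M) (x : M) : Coord n → Coord n :=
  extChartAt (𝓡 n) (f x) ∘ f ∘ (extChartAt (𝓡 n) x).symm

lemma eventually_mem_target (x : M) :
    ∀ᶠ v in nhds (extChartAt (𝓡 n) x x), v ∈ (extChartAt (𝓡 n) x).target :=
  extChartAt_target_mem_nhds x

lemma contDiffAt_mapInChart {f : M → M} {x : M} (hf : ContMDiffAt (𝓡 n) (𝓡 n) ∞ f x) :
    ContDiffAt ℝ ∞ (mapInChart f x) (extChartAt (𝓡 n) x x) := by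
  have := (contMDiffAt_iff.1 hf).2
  simpa [mapInChart, contDiffWithinAt_univ] using this

lemma contDiffAt_inChart_base {φ : M → ℝ} {x : M} (hφ : ContMDiffAt (𝓡 n) 𝓘(ℝ, ℝ) ∞ φ x) :
    ContDiffAt ℝ ∞ (φ ∘ (extChartAt (𝓡 n) x).symm) (extChartAt (𝓡 n) x x) := by
  have := (contMDiffAt_iff.1 hφ).2
  rw [modelWithCornersSelf_coe, Set.range_id, contDiffWithinAt_univ] at this
  exact this

lemma fderiv_mapInChart {f : M → M} {x : M} (hf : ContMDiffAt (𝓡 n) (𝓡 n) ∞ f x) :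
    fderiv ℝ (mapInChart f x) (extChartAt (𝓡 n) x x) = mfderiv (𝓡 n) (𝓡 n) f x := by
  rw [(hf.mdifferentiableAt (by simp)).mfderiv]
  simp only [writtenInExtChartAt, mapInChart, modelWithCornersSelf_coe, Set.range_id,
    fderivWithin_univ]

lemma tangentMap_snd_ne_zero (h : M ≃ₘ⟮𝓡 n, 𝓡 n⟯ M) {z : TangentBundle (𝓡 n) M} (hz : z.2 ≠ 0) :
    (tangentMap (𝓡 n) (𝓡 n) h z).2 ≠ 0 := by
  intro h0
  apply hz
  apply (h.mfderivToContinuousLinearEquiv (by simp) z.proj).injective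
  rw [map_zero]
  exact h0

end BaseCharts

section InCharts

variable {n : ℕ} {M : Type*} [TopologicalSpace M] [ChartedSpace (EuclideanSpace ℝ (Fin n)) M]
  [IsManifold (𝓡 n) ∞ M]

lemma coordAt_eq (z : TangentBundle (𝓡 n) M) :
    coordAt z = (extChartAt (𝓡 n) z.proj z.proj, z.2) := by
  refine Prod.ext rfl ?_
  exact (tangentBundleCore (𝓡 n) M).coordChange_self (achart _ z.proj) z.proj
    (mem_chart_source _ z.proj) z.2

lemma extChartAt_tangent_symm_apply (z : TangentBundle (𝓡 n) M)
    (y : TangentSpace (𝓡 n) z.proj) :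
    (extChartAt (𝓡 n).tangent z).symm (extChartAt (𝓡 n) z.proj z.proj, y) = ⟨z.proj, y⟩ := by
  have h := coordAt_eq (⟨z.proj, y⟩ : TangentBundle (𝓡 n) M)
  have h2 := (extChartAt (𝓡 n).tangent (⟨z.proj, y⟩ : TangentBundle (𝓡 n) M)).left_inv
    (mem_extChartAt_source _)
  rw [coordAt] at h
  rw [h] at h2
  exact h2

/-- In charts, the tangent map of `f` is the tangent lift of the chart representation of `f`. -/
lemma tangentMap_inChart {f : M → M} (hf : ContMDiff (𝓡 n) (𝓡 n) ∞ f)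
    (z : TangentBundle (𝓡 n) M) :
    ∀ᶠ w in nhds (coordAt z), tangentMap (𝓡 n) (𝓡 n) f ((extChartAt (𝓡 n).tangent z).symm w)
      = (extChartAt (𝓡 n).tangent (tangentMap (𝓡 n) (𝓡 n) f z)).symm
        (tangentLift (mapInChart f z.proj) w) := by
  set x := z.proj with hx
  have hc : Filter.Tendsto Prod.fst (nhds (coordAt z)) (nhds (extChartAt (𝓡 n) x x)) := by
    rw [coordAt_eq]; exact continuous_fst.tendsto _
  have h1 := hc.eventually (eventually_mem_target x)
  have h2 : ∀ᶠ v in nhds (extChartAt (𝓡 n) x x),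
      f ((extChartAt (𝓡 n) x).symm v) ∈ (chartAt (EuclideanSpace ℝ (Fin n)) (f x)).source := by
    have hcont : ContinuousAt (fun v => f ((extChartAt (𝓡 n) x).symm v)) (extChartAt (𝓡 n) x x) :=
      hf.continuous.continuousAt.comp (continuousAt_extChartAt_symm x)
    refine hcont.eventually_mem ((chartAt _ (f x)).open_source.mem_nhds ?_)
    rw [extChartAt_to_inv]
    exact mem_chart_source _ _
  filter_upwards [h1, hc.eventually h2] with w hw1 hw2
  set z' := tangentMap (𝓡 n) (𝓡 n) f z with hz'
  set p := (extChartAt (𝓡 n).tangent z).symm w with hp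
  let q : TangentBundle (𝓡 n) (EuclideanSpace ℝ (Fin n)) := ⟨w.1, w.2⟩
  have hw1' : q.proj ∈ (chartAt (EuclideanSpace ℝ (Fin n)) z.proj).target := by
    simpa using hw1
  have hsymm : tangentMap (𝓡 n) (𝓡 n) (chartAt (EuclideanSpace ℝ (Fin n)) z.proj).symm q = p :=
    tangentMap_chart_symm hw1'
  have hpproj : p.proj = (chartAt (EuclideanSpace ℝ (Fin n)) z.proj).symm w.1 := by
    rw [← hsymm]; rfl
  have hfp : (tangentMap (𝓡 n) (𝓡 n) f p).proj
      ∈ (chartAt (EuclideanSpace ℝ (Fin n)) z'.proj).source := by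
    change f p.proj ∈ _
    rw [hpproj]; exact hw2
  have hchart := tangentMap_chart (I := 𝓡 n) hfp
  have hd1 : MDifferentiableAt (𝓡 n) (𝓡 n) (chartAt (EuclideanSpace ℝ (Fin n)) z.proj).symm q.proj :=
    mdifferentiableAt_atlas_symm (chart_mem_atlas _ _) hw1'
  have hd2 : MDifferentiableAt (𝓡 n) (𝓡 n) f p.proj := hf.mdifferentiableAt (by simp)
  have hd3 : MDifferentiableAt (𝓡 n) (𝓡 n) (chartAt (EuclideanSpace ℝ (Fin n)) z'.proj)
      (f p.proj) := mdifferentiableAt_atlas (chart_mem_atlas _ _) hfp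
  have hcomp : tangentMap (𝓡 n) (𝓡 n) (chartAt (EuclideanSpace ℝ (Fin n)) z'.proj)
        (tangentMap (𝓡 n) (𝓡 n) f p)
      = tangentMap (𝓡 n) (𝓡 n) (mapInChart f x) q := by
    rw [← hsymm, ← tangentMap_comp_at (I' := 𝓡 n) q (by rw [hpproj] at hd2; exact hd2) hd1]
    rw [← tangentMap_comp_at (I' := 𝓡 n) q
      (by rw [hpproj] at hd3; exact hd3) ((by rw [hpproj] at hd2; exact hd2 : MDifferentiableAt
        (𝓡 n) (𝓡 n) f _).comp _ hd1)]
    rfl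
  have hlift : chartAt (ModelProd (EuclideanSpace ℝ (Fin n)) (EuclideanSpace ℝ (Fin n))) z'
      (tangentMap (𝓡 n) (𝓡 n) f p) = tangentLift (mapInChart f x) w := by
    have h4 := congrArg (Bundle.TotalSpace.toProd (EuclideanSpace ℝ (Fin n))
      (EuclideanSpace ℝ (Fin n))) (hchart.symm.trans hcomp)
    rw [Equiv.apply_symm_apply] at h4
    rw [h4]
    refine Prod.ext rfl ?_
    change mfderiv (𝓡 n) (𝓡 n) (mapInChart f x) w.1 w.2 = _
    rw [mfderiv_eq_fderiv]
    rfl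
  rw [← hlift]
  refine ((chartAt (ModelProd (EuclideanSpace ℝ (Fin n)) (EuclideanSpace ℝ (Fin n))) z').left_inv ?_).symm
  rw [TangentBundle.mem_chart_source_iff]
  exact hfp

lemma coordAt_tangentMap {f : M → M} (hf : ContMDiff (𝓡 n) (𝓡 n) ∞ f)
    (z : TangentBundle (𝓡 n) M) :
    coordAt (tangentMap (𝓡 n) (𝓡 n) f z) = tangentLift (mapInChart f z.proj) (coordAt z) := by
  rw [coordAt_eq, coordAt_eq]
  refine Prod.ext ?_ ?_
  · simp [mapInChart, tangentMap, tangentLift]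
  · change mfderiv (𝓡 n) (𝓡 n) f z.proj z.2 = fderiv ℝ (mapInChart f z.proj) _ z.2
    rw [fderiv_mapInChart hf.contMDiffAt]
    rfl

lemma eventually_snd_ne_zero {z : TangentBundle (𝓡 n) M} (hz : z.2 ≠ 0) :
    ∀ᶠ p : TangentBundle (𝓡 n) M in nhds z, p.2 ≠ 0 := by
  have hc : ContinuousAt (fun p => (extChartAt (𝓡 n).tangent z p).2) z :=
    continuous_snd.continuousAt.comp (continuousAt_extChartAt z)
  have h0 : (extChartAt (𝓡 n).tangent z z).2 ≠ 0 := by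
    have := congrArg Prod.snd (coordAt_eq z)
    rw [coordAt] at this
    rw [this]; exact hz
  filter_upwards [hc.eventually_ne h0] with p hp h
  apply hp
  change (tangentBundleCore (𝓡 n) M).coordChange (achart _ p.proj) (achart _ z.proj) p.proj p.2 = 0
  rw [h]
  exact ((tangentBundleCore (𝓡 n) M).coordChange (achart _ p.proj) (achart _ z.proj)
    p.proj).map_zero

namespace FinslerStructure

lemma contDiffAt_inChart (F : FinslerStructure n M) {z : TangentBundle (𝓡 n) M} (hz : z.2 ≠ 0) :
    ContDiffAt ℝ ∞ (fun w => inChart F.toFun z w ^ 2) (coordAt z) := by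
  have h := (contMDiffAt_iff.1 (F.smooth.contMDiffAt (eventually_snd_ne_zero hz))).2
  have hr : Set.range (𝓡 n).tangent = Set.univ := by
    simp [ModelWithCorners.tangent]
  rw [hr, contDiffWithinAt_univ] at h
  exact ContDiffAt.pow h 2

/-- If the Schwarzian tensor of `φ` vanishes over `x` and `dφ ≠ 0` at `x`, then `F` is Riemannian
on the fibre over `x`. -/
lemma isVertFlat (F : FinslerStructure n M) {φ : M → ℝ} {z : TangentBundle (𝓡 n) M}
    (h : ∀ y : TangentSpace (𝓡 n) z.proj, y ≠ 0 → ∀ X Y, schwarzian F φ ⟨z.proj, y⟩ X Y = 0)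
    (hd : fderiv ℝ (φ ∘ (extChartAt (𝓡 n) z.proj).symm) (extChartAt (𝓡 n) z.proj z.proj) ≠ 0)
    (hz : z.2 ≠ 0) : IsVertFlat (fun w => inChart F.toFun z w ^ 2) (coordAt z) := by
  rw [coordAt_eq]
  refine isVertFlat_of_schwarzianLoc_eq_zero (x := extChartAt (𝓡 n) z.proj z.proj)
    (u := φ ∘ (extChartAt (𝓡 n) z.proj).symm) ?_ ?_ ?_ ?_ hd hz
  · intro y hy
    have := F.contDiffAt_inChart (z := ⟨z.proj, y⟩) hy
    rwa [coordAt_eq] at this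
  · intro y c hc
    simp only [inChart]
    have h1 := extChartAt_tangent_symm_apply z y
    have h2 := extChartAt_tangent_symm_apply z (c • y)
    have h3 := F.homogeneous z.proj y c hc
    exact (congrArg F.toFun h2).trans (h3.trans (congrArg (fun p => c * F.toFun p) h1.symm))
  · intro y hy
    have := F.posDef ⟨z.proj, y⟩ hy
    rwa [coordAt_eq] at this
  · intro y hy X Y
    have h1 : schwarzianLoc (inChart F.toFun z) (φ ∘ (extChartAt (𝓡 n) z.proj).symm)
        (coordAt (⟨z.proj, y⟩ : TangentBundle (𝓡 n) M)) X Y = 0 := h y hy X Y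
    rw [coordAt_eq] at h1
    exact h1

end FinslerStructure

/-- The conformal relation `h^*F = e^ψ F` in charts. -/
lemma IsConformalWith.inChart_eventuallyEq {F : FinslerStructure n M} {h : M ≃ₘ⟮𝓡 n, 𝓡 n⟯ M}
    {ψ : M → ℝ} (hh : IsConformalWith F h ψ) (z : TangentBundle (𝓡 n) M) :
    inChart F.toFun z =ᶠ[nhds (coordAt z)] fun w =>
      Real.exp (-(ψ ∘ (extChartAt (𝓡 n) z.proj).symm) w.1)
        * inChart F.toFun (tangentMap (𝓡 n) (𝓡 n) h z)
          (tangentLift (mapInChart h z.proj) w) := by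
  filter_upwards [tangentMap_inChart h.contMDiff z] with w hw
  have h1 := hh.2 ((extChartAt (𝓡 n).tangent z).symm w)
  simp only [inChart]
  rw [← hw, h1, ← mul_assoc, ← Real.exp_add]
  have h2 : ((extChartAt (𝓡 n).tangent z).symm w).proj = (extChartAt (𝓡 n) z.proj).symm w.1 := rfl
  rw [h2]
  simp

lemma pos_of_ne_zero {v : Coord n} (hv : v ≠ 0) : 0 < n := by
  rcases Nat.eq_zero_or_pos n with h | h
  · subst h
    exact absurd (Subsingleton.elim v 0) hv
  · exact h

/-- If `h^*F = e^ψ F` and the Schwarzian tensor of `φ` vanishes, then the Schwarzian tensors of `ψ`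
and of `φ ∘ h + ψ` vanish simultaneously. -/
theorem IsConformalWith.schwarzian_eq_zero_iff {F : FinslerStructure n M}
    {h : M ≃ₘ⟮𝓡 n, 𝓡 n⟯ M} {φ ψ : M → ℝ} (hh : IsConformalWith F h ψ)
    (hφ : ContMDiff (𝓡 n) 𝓘(ℝ, ℝ) ∞ φ)
    (hB : ∀ z : TangentBundle (𝓡 n) M, z.2 ≠ 0 → ∀ X Y, schwarzian F φ z X Y = 0) :
    (∀ z : TangentBundle (𝓡 n) M, z.2 ≠ 0 → ∀ X Y, schwarzian F ψ z X Y = 0) ↔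
      ∀ z : TangentBundle (𝓡 n) M, z.2 ≠ 0 →
        ∀ X Y, schwarzian F (fun x => φ (h x) + ψ x) z X Y = 0 := by
  have main : ∀ z : TangentBundle (𝓡 n) M, z.2 ≠ 0 →
      ((∀ z : TangentBundle (𝓡 n) M, z.2 ≠ 0 → ∀ X Y, schwarzian F ψ z X Y = 0) ∨
        ∀ z : TangentBundle (𝓡 n) M, z.2 ≠ 0 →
          ∀ X Y, schwarzian F (fun x => φ (h x) + ψ x) z X Y = 0) →
      ((∀ X Y, schwarzian F ψ z X Y = 0) ↔
        ∀ X Y, schwarzian F (fun x => φ (h x) + ψ x) z X Y = 0) := by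
    intro z hz hor
    set x := z.proj with hx
    set z' := tangentMap (𝓡 n) (𝓡 n) h z with hz'
    set T : Coord n → Coord n := mapInChart h x with hT
    set u := φ ∘ (extChartAt (𝓡 n) (h x)).symm with hu
    set v := ψ ∘ (extChartAt (𝓡 n) x).symm with hv
    have hzne : z'.2 ≠ 0 := tangentMap_snd_ne_zero h hz
    have hco : coordAt z' = tangentLift T (coordAt z) := coordAt_tangentMap h.contMDiff z
    have hc1 : (coordAt z).1 = extChartAt (𝓡 n) x x := by rw [coordAt_eq]
    have hTx : T (extChartAt (𝓡 n) x x) = extChartAt (𝓡 n) (h x) (h x) := by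
      simp [hT, mapInChart]
    have hTs : ContDiffAt ℝ ∞ T (coordAt z).1 := by
      rw [hc1]; exact contDiffAt_mapInChart h.contMDiff.contMDiffAt
    have hvs : ContDiffAt ℝ ∞ v (coordAt z).1 := by
      rw [hc1]; exact contDiffAt_inChart_base hh.1.contMDiffAt
    have hus : ContDiffAt ℝ ∞ u (T (coordAt z).1) := by
      rw [hc1, hTx]; exact contDiffAt_inChart_base hφ.contMDiffAt
    have hsurj : Function.Surjective (fderiv ℝ T (coordAt z).1) := by
      rw [hc1, fderiv_mapInChart h.contMDiff.contMDiffAt]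
      exact (h.mfderivToContinuousLinearEquiv (by simp) x).surjective
    have hχ : (fun x => φ (h x) + ψ x) ∘ (extChartAt (𝓡 n) x).symm
        =ᶠ[nhds (coordAt z).1] fun y => u (T y) + v y := by
      rw [hc1]
      have hcont : ContinuousAt (fun v => h ((extChartAt (𝓡 n) x).symm v))
          (extChartAt (𝓡 n) x x) :=
        h.contMDiff.continuous.continuousAt.comp (continuousAt_extChartAt_symm x)
      have hmem : ∀ᶠ y in nhds (extChartAt (𝓡 n) x x),
          h ((extChartAt (𝓡 n) x).symm y) ∈ (extChartAt (𝓡 n) (h x)).source := by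
        refine hcont.eventually_mem (extChartAt_source_mem_nhds' ?_)
        rw [extChartAt_to_inv]
        exact mem_extChartAt_source _
      filter_upwards [hmem] with y hy
      simp only [hu, hv, hT, mapInChart, Function.comp_apply]
      rw [(extChartAt (𝓡 n) (h x)).left_inv hy]
    have hcase : (IsVertFlat (fun w => inChart F.toFun z w ^ 2) (coordAt z) ∨
        IsVertFlat (fun w => inChart F.toFun z' w ^ 2) (tangentLift T (coordAt z))) ∨
        (fderiv ℝ u (T (coordAt z).1) = 0 ∧ fderiv ℝ v (coordAt z).1 = 0) := by
      by_cases h1 : fderiv ℝ u (T (coordAt z).1) = 0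
      · by_cases h2 : fderiv ℝ v (coordAt z).1 = 0
        · exact Or.inr ⟨h1, h2⟩
        · refine Or.inl (Or.inl ?_)
          rcases hor with hψ | hχ'
          · refine F.isVertFlat (φ := ψ) (fun y hy => hψ _ hy) ?_ hz
            rw [hc1] at h2
            exact h2
          · refine F.isVertFlat (φ := fun x => φ (h x) + ψ x) (fun y hy => hχ' _ hy) ?_ hz
            rw [← hc1, hχ.fderiv_eq]
            intro h3
            apply h2
            ext X
            have h4 := fderiv_comp_add hTs hus hvs X
            rw [h3, h1] at h4
            simpa using h4.symm
      · refine Or.inl (Or.inr ?_)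
        rw [← hco]
        refine F.isVertFlat (φ := φ) (z := z') (fun y hy => hB _ hy) ?_ hzne
        rw [hc1, hTx] at h1
        exact h1
    have key := schwarzianLoc_pullback (L' := inChart F.toFun z) (L := inChart F.toFun z')
      (T := T) (w := coordAt z) (u := u) (ψ := v) (pos_of_ne_zero (v := z.2) hz)
      (by rw [← hco]; exact F.contDiffAt_inChart hzne) (F.contDiffAt_inChart hz)
      (by rw [← hco]; exact F.posDef _ hzne) (F.posDef _ hz) hTs hsurj hvs hus
      (hh.inChart_eventuallyEq z) hcase
      (by rw [← hco]; exact hB z' hzne)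
    refine key.trans ?_
    refine forall_congr' fun X => forall_congr' fun Y => ?_
    have hXY := schwarzianLoc_congr (L := inChart F.toFun z) (z := coordAt z) hχ X Y
    exact ⟨fun h => hXY.trans h, fun h => hXY.symm.trans h⟩
  exact ⟨fun hψ z hz => (main z hz (Or.inl hψ)).1 (hψ z hz),
    fun hχ z hz => (main z hz (Or.inr hχ)).2 (hχ z hz)⟩

end InCharts

section Groups

variable {n : ℕ} {M : Type*} [TopologicalSpace M] [ChartedSpace (EuclideanSpace ℝ (Fin n)) M]
  [IsManifold (𝓡 n) ∞ M] {F : FinslerStructure n M} {f h : M ≃ₘ⟮𝓡 n, 𝓡 n⟯ M} {φ ψ : M → ℝ}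

lemma IsConformalWith.mul (hf : IsConformalWith F f φ) (hh : IsConformalWith F h ψ) :
    IsConformalWith F (f * h) fun x => φ (h x) + ψ x := by
  refine ⟨(hf.1.comp h.contMDiff).add hh.1, fun z => ?_⟩
  have h1 : tangentMap (𝓡 n) (𝓡 n) (f * h : M ≃ₘ⟮𝓡 n, 𝓡 n⟯ M) z
      = tangentMap (𝓡 n) (𝓡 n) f (tangentMap (𝓡 n) (𝓡 n) h z) :=
    tangentMap_comp_at (g := f) (f := h) z (f.contMDiff.mdifferentiableAt (by simp))
      (h.contMDiff.mdifferentiableAt (by simp))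
  rw [h1, hf.2, hh.2, Real.exp_add, mul_assoc]
  rfl

lemma isConformalWith_one : IsConformalWith F 1 fun _ => 0 := by
  refine ⟨contMDiff_const, fun z => ?_⟩
  have h1 : tangentMap (𝓡 n) (𝓡 n) ((1 : M ≃ₘ⟮𝓡 n, 𝓡 n⟯ M) : M → M) z = z := by
    have := congrFun (tangentMap_id (I := 𝓡 n) (M := M)) z
    exact this
  rw [h1]; simp

lemma IsConformalWith.inv (hf : IsConformalWith F f φ) :
    IsConformalWith F f⁻¹ fun x => -φ (f⁻¹ x) := by
  refine ⟨(hf.1.comp f⁻¹.contMDiff).neg, fun z => ?_⟩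
  have h1 : tangentMap (𝓡 n) (𝓡 n) f (tangentMap (𝓡 n) (𝓡 n) (f⁻¹ : M ≃ₘ⟮𝓡 n, 𝓡 n⟯ M) z) = z := by
    rw [← tangentMap_comp_at (g := f) (f := (f⁻¹ : M ≃ₘ⟮𝓡 n, 𝓡 n⟯ M)) z
      (f.contMDiff.mdifferentiableAt (by simp)) (f⁻¹.contMDiff.mdifferentiableAt (by simp))]
    have h2 : (f : M → M) ∘ (f⁻¹ : M ≃ₘ⟮𝓡 n, 𝓡 n⟯ M) = id := by
      funext x
      exact f.apply_symm_apply x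
    rw [h2, tangentMap_id]; rfl
  have h2 := hf.2 (tangentMap (𝓡 n) (𝓡 n) (f⁻¹ : M ≃ₘ⟮𝓡 n, 𝓡 n⟯ M) z)
  rw [h1] at h2
  rw [h2, ← mul_assoc, ← Real.exp_add]
  simp [tangentMap]

lemma schwarzian_const (F : FinslerStructure n M) (c : ℝ) (z : TangentBundle (𝓡 n) M)
    (X : TangentSpace (𝓡 n).tangent z) (Y : TangentSpace (𝓡 n) z.proj) :
    schwarzian F (fun _ => c) z X Y = 0 :=
  schwarzianLoc_const c _ _ _

variable (F)

/-- The conformal group of `(M, F)`. -/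
def conformalGroup : Subgroup (M ≃ₘ⟮𝓡 n, 𝓡 n⟯ M) where
  carrier := {f | IsConformal F f}
  mul_mem' := fun ⟨_, hf⟩ ⟨_, hh⟩ => ⟨_, hf.mul hh⟩
  one_mem' := ⟨_, isConformalWith_one⟩
  inv_mem' := fun ⟨_, hf⟩ => ⟨_, hf.inv⟩

/-- The group of Möbius transformations of `(M, F)`. -/
def mobiusGroup : Subgroup (M ≃ₘ⟮𝓡 n, 𝓡 n⟯ M) where
  carrier := {f | IsMobius F f}
  mul_mem' := by
    rintro f h ⟨φ, hf, hBf⟩ ⟨ψ, hh, hBh⟩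
    exact ⟨_, hf.mul hh, (hh.schwarzian_eq_zero_iff hf.1 hBf).1 hBh⟩
  one_mem' := ⟨_, isConformalWith_one, fun z _ X Y => schwarzian_const F 0 z X Y⟩
  inv_mem' := by
    rintro f ⟨φ, hf, hBf⟩
    refine ⟨_, hf.inv, (hf.inv.schwarzian_eq_zero_iff hf.1 hBf).2 fun z _ X Y => ?_⟩
    simp only [add_neg_cancel]
    exact schwarzian_const F 0 z X Y

/-- The group of homotheties of `(M, F)`. -/
def homothetyGroup : Subgroup (M ≃ₘ⟮𝓡 n, 𝓡 n⟯ M) where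
  carrier := {f | IsHomothety F f}
  mul_mem' := fun ⟨_, hf⟩ ⟨_, hh⟩ => ⟨_, hf.mul hh⟩
  one_mem' := ⟨0, isConformalWith_one⟩
  inv_mem' := fun ⟨_, hf⟩ => ⟨_, hf.inv⟩

end Groups

end Finsler

end

theorem theorem1p1 {n : ℕ} {M : Type*} [TopologicalSpace M]
    [ChartedSpace (EuclideanSpace ℝ (Fin n)) M] [IsManifold (𝓡 n) ∞ M]
    (F : Finsler.FinslerStructure n M) :
    ∃ Conf Mob Hom : Subgroup (M ≃ₘ⟮𝓡 n, 𝓡 n⟯ M),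
      (∀ f, f ∈ Conf ↔ Finsler.IsConformal F f) ∧
      (∀ f, f ∈ Mob ↔ Finsler.IsMobius F f) ∧
      (∀ f, f ∈ Hom ↔ Finsler.IsHomothety F f) ∧
      Mob ≤ Conf ∧ Hom ≤ Mob := by
  exact ⟨Finsler.conformalGroup F, Finsler.mobiusGroup F, Finsler.homothetyGroup F,
    fun _ => Iff.rfl, fun _ => Iff.rfl, fun _ => Iff.rfl,
    fun _ ⟨φ, hf, _⟩ => ⟨φ, hf⟩,
    fun _ ⟨c, hf⟩ => ⟨fun _ => c, hf, fun z _ X Y => Finsler.schwarzian_const F c z X Y⟩⟩
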